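/- All graphs are simple and undirected. A CB-graph is a connected graph in which, for every vertex $v$ and every integer $r\ge 1$, the ball $B_r(v)=\{w: d(v,w)\le r\}$ is convex; here a set $C$ of vertices is convex if for all $u,w\in C$ it contains every vertex $x$ with $d(u,w)=d(u,x)+d(x,w)$. A finite graph is 2-connected if it has at least three vertices, is connected, and remains connected after the deletion of any one vertex. A block of a graph is a maximal subgraph that is connected and has no cut vertex of its own. A Moore graph of degree $d$ and diameter $k$ is a finite $d$-regular graph of diameter $k$ with exactly $1+d\sum_{i=0}^{k-1}(d-1)^i$ vertices (for $k=2$: $d^2+1$ vertices). **Proposition.** A finite graph is 2-connected, triangle-free and a CB-graph if and only if it is a Moore graph of diameter $2$ (of some degree $d$). Moreover, every block of a finite triangle-free CB-graph is, up to isomorphism, a single vertex, a single edge, the pentagon $C_5$, the Petersen graph, the Hoffman–Singleton graph, or a (hypothetical) Moore graph of diameter $2$ and degree $57$. In particular, every block with at least three vertices is one of the last four. -/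

import Mathlib

namespace SimpleGraph

variable {V : Type*}

/-- The interval `I(u, v)`: all vertices on shortest paths between `u` and `v`
(in a connected graph). -/
def distInterval (G : SimpleGraph V) (u v : V) : Set V :=
  {x | G.dist u v = G.dist u x + G.dist x v}

/-- A set of vertices is convex if it contains the interval between any two of its members. -/
def IsGeodesicallyConvex (G : SimpleGraph V) (C : Set V) : Prop :=
  ∀ u ∈ C, ∀ v ∈ C, G.distInterval u v ⊆ C

/-- The ball of radius `r` around `v` (in a connected graph). -/
def distBall (G : SimpleGraph V) (v : V) (r : ℕ) : Set V :=
  {w | G.dist v w ≤ r}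

/-- A graph with convex balls: a connected graph all of whose balls are convex. -/
def IsCBGraph (G : SimpleGraph V) : Prop :=
  G.Connected ∧ ∀ (v : V) (r : ℕ), 1 ≤ r → G.IsGeodesicallyConvex (G.distBall v r)

/-- A connected graph without a cut vertex. (`Preconnected` because deleting the only vertex of
the one-vertex graph leaves the empty graph.) -/
def IsNonseparable (G : SimpleGraph V) : Prop :=
  G.Connected ∧ ∀ v : V, (G.induce {w | w ≠ v}).Preconnected

/-- A finite graph is 2-connected if it has at least three vertices, is connected and has no
cut vertex. -/
def IsTwoConnected (G : SimpleGraph V) : Prop :=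
  3 ≤ Nat.card V ∧ G.IsNonseparable

/-- A block is a maximal subgraph that is connected and has no cut vertex of its own. -/
def IsBlock (G : SimpleGraph V) (B : G.Subgraph) : Prop :=
  Maximal (fun H : G.Subgraph ↦ H.coe.IsNonseparable) B

/-- A Moore graph of degree `d` and diameter `k`: a `d`-regular graph of diameter `k` whose
number of vertices attains the Moore bound `1 + d * ∑ i < k, (d - 1) ^ i`.
The bound is positive, so `Nat.card V` being equal to it forces `V` to be finite. -/
def IsMooreGraph (G : SimpleGraph V) (d k : ℕ) : Prop :=
  (∀ v : V, (G.neighborSet v).ncard = d) ∧ G.ediam = k ∧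
    Nat.card V = 1 + d * ∑ i ∈ Finset.range k, (d - 1) ^ i

/-- The Petersen graph: the 2-element subsets of a 5-element set, adjacent when disjoint. -/
def petersenGraph : SimpleGraph {s : Finset (Fin 5) // s.card = 2} where
  Adj s t := Disjoint s.1 t.1
  symm := ⟨fun _ _ h ↦ h.symm⟩
  loopless := ⟨fun s h ↦ by
    have h0 : s.1 = ∅ := disjoint_self.mp h
    have h2 := s.2
    simp [h0] at h2⟩

/-- Adjacency in the pentagon-pentagram model of the Hoffman–Singleton graph: `inl (h, j)` is the
vertex `j` of the pentagon `P_h`, `inr (i, k)` is the vertex `k` of the pentagram `Q_i`, and the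
vertex `j` of `P_h` is joined to the vertex `h * i + j` of `Q_i`. -/
def hoffmanSingletonAdj :
    (ZMod 5 × ZMod 5) ⊕ (ZMod 5 × ZMod 5) → (ZMod 5 × ZMod 5) ⊕ (ZMod 5 × ZMod 5) → Prop
  | .inl (h, j), .inl (h', j') => h = h' ∧ (j' = j + 1 ∨ j = j' + 1)
  | .inr (i, k), .inr (i', k') => i = i' ∧ (k' = k + 2 ∨ k = k' + 2)
  | .inl (h, j), .inr (i, k) => k = h * i + j
  | .inr (i, k), .inl (h, j) => k = h * i + j

/-- The Hoffman–Singleton graph. -/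
def hoffmanSingletonGraph : SimpleGraph ((ZMod 5 × ZMod 5) ⊕ (ZMod 5 × ZMod 5)) where
  Adj := hoffmanSingletonAdj
  symm := ⟨by
    rintro (⟨a, b⟩ | ⟨a, b⟩) (⟨c, d⟩ | ⟨c, d⟩) h
    · exact ⟨h.1.symm, h.2.symm⟩
    · exact h
    · exact h
    · exact ⟨h.1.symm, h.2.symm⟩⟩
  loopless := ⟨by
    rintro (⟨a, b⟩ | ⟨a, b⟩) ⟨-, h⟩ <;> revert b <;> decide⟩

end SimpleGraph

/-! In a triangle-free CB-graph, fix `v`. Every other vertex has a unique neighbor nearer to `v`,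
since it would lie between two such neighbors and hence in a ball that is too small for it; in
particular there are no quadrangles. Convexity also gives the pentagon condition: an edge with both
ends at the same distance from `v` lies in a pentagon whose opposite vertex is two levels closer to
`v`.

Call two neighbors of `a` related if they are equal or lie in a pentagon with `a`. Two pentagons
sharing an edge at `a` lie so close together that they yield a third, so the relation is transitive.
By the pentagon condition, an edge avoiding `a` never leaves the branches of related neighbors.
Hence, if `a` is not a cut vertex, all its neighbors are related (`exists_pentagon`). A geodesic of
length three would then be covered by two pentagons overlapping in its middle edge, which forces its
ends within distance two. So the diameter is at most two, and comparing neighborhoods gives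
regularity. The converse rests on counting walks of length two.

A block contains every path between two of its vertices, so it is isometric and inherits the
hypotheses. For a Moore graph of degree `d`, the equation `A² = (d - 1)I - A + J` and the
integrality of eigenvalue multiplicities leave only `d = 2, 3, 7, 57`. For `d = 2` and `d = 3`, a
pentagon and its outer neighbors determine the graph. For `d = 7`, a dimension count in the
eigenspace of `2` (`outer_walk_closed`) shows that the outer neighbors of any pentagon split into
five pentagrams. This gives five pentagons and five pentagrams whose mutual matchings are shifts;
absence of quadrangles makes the shifts a multiplication table over `ℤ/5`. -/

namespace SimpleGraph

variable {V : Type*} {G : SimpleGraph V} {d : ℕ}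

/-- A graph without triangles and quadrangles in which any two nonadjacent vertices have a
common neighbor. -/
structure IsGirthFiveDiamTwo (G : SimpleGraph V) : Prop where
  not_adj : ∀ {a b c : V}, G.Adj a b → G.Adj b c → ¬ G.Adj a c
  eq_of_adj : ∀ {a b x y : V}, a ≠ b → G.Adj a x → G.Adj x b → G.Adj a y → G.Adj y b → x = y
  exists_adj_adj : ∀ {a b : V}, a ≠ b → ¬ G.Adj a b → ∃ x, G.Adj a x ∧ G.Adj x b

/-! ### Moore graphs of diameter two as graphs of girth five: counting -/

section Counting

variable [Fintype V] [DecidableEq V] [DecidableRel G.Adj]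

lemma card_sigma_neighborFinset_erase (hd : G.IsRegularOfDegree d) (v : V) :
    ((G.neighborFinset v).sigma fun x ↦ (G.neighborFinset x).erase v).card = d * (d - 1) := by
  rw [Finset.card_sigma, Finset.sum_congr rfl (g := fun _ ↦ d - 1)]
  · simp [hd v]
  · intro x hx
    rw [Finset.card_erase_of_mem (by simpa [adj_comm] using hx), card_neighborFinset_eq_degree, hd x]

lemma card_compl_insert_neighborFinset (hd : G.IsRegularOfDegree d) (v : V) :
    (insert v (G.neighborFinset v))ᶜ.card = Fintype.card V - (d + 1) := by
  rw [Finset.card_compl, Finset.card_insert_of_notMem (by simp), card_neighborFinset_eq_degree, hd v]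

/-- The endpoint map from nonbacktracking walks `v, x, y` to the vertices outside the closed
neighborhood of `v` is a bijection: triangles, quadrangles and larger distances are the only
obstructions. -/
lemma IsGirthFiveDiamTwo.card_eq (h : G.IsGirthFiveDiamTwo) (hd : G.IsRegularOfDegree d)
    [Nonempty V] : Fintype.card V = d * (d - 1) + (d + 1) := by
  obtain ⟨v⟩ := ‹Nonempty V›
  have h1 := card_compl_insert_neighborFinset hd v
  have h2 := card_sigma_neighborFinset_erase hd v
  have h3 : (insert v (G.neighborFinset v))ᶜ.card =
      ((G.neighborFinset v).sigma fun x ↦ (G.neighborFinset x).erase v).card := by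
    symm
    refine Finset.card_bij (fun p _ ↦ p.2) ?_ ?_ ?_
    · rintro ⟨x, y⟩ hxy
      simp only [Finset.mem_sigma, mem_neighborFinset, Finset.mem_erase] at hxy
      simp only [Finset.mem_compl, Finset.mem_insert, mem_neighborFinset, not_or]
      exact ⟨hxy.2.1, h.not_adj hxy.1 hxy.2.2⟩
    · rintro ⟨x, y⟩ hxy ⟨x', y'⟩ hxy' (rfl : y = y')
      simp only [Finset.mem_sigma, mem_neighborFinset, Finset.mem_erase] at hxy hxy'
      obtain rfl := h.eq_of_adj hxy.2.1.symm hxy.1 hxy.2.2 hxy'.1 hxy'.2.2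
      rfl
    · intro y hy
      simp only [Finset.mem_compl, Finset.mem_insert, mem_neighborFinset, not_or] at hy
      obtain ⟨x, hx, hxy⟩ := h.exists_adj_adj (Ne.symm hy.1) hy.2
      exact ⟨⟨x, y⟩, by simp [hx, hxy, hy.1], rfl⟩
  have h4 : d + 1 ≤ Fintype.card V := by
    rw [← hd v, ← card_neighborFinset_eq_degree,
      ← Finset.card_insert_of_notMem (a := v) (s := G.neighborFinset v) (by simp)]
    exact Finset.card_le_univ _
  omega

/-- The same endpoint map covers all nonneighbors of `v`. Equality of cardinalities makes it
injective (no quadrangles) and keeps its image away from the neighbors (no triangles). -/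
lemma isGirthFiveDiamTwo_of_card (hd : G.IsRegularOfDegree d)
    (hc : Fintype.card V = d * (d - 1) + (d + 1))
    (hm : ∀ {a b : V}, a ≠ b → ¬ G.Adj a b → ∃ x, G.Adj a x ∧ G.Adj x b) :
    G.IsGirthFiveDiamTwo := by
  have key (v : V) : ((G.neighborFinset v).sigma fun x ↦ (G.neighborFinset x).erase v).image
        (fun p ↦ p.2) = (insert v (G.neighborFinset v))ᶜ ∧
      (((G.neighborFinset v).sigma fun x ↦ (G.neighborFinset x).erase v).image
        (fun p ↦ p.2)).card =
      ((G.neighborFinset v).sigma fun x ↦ (G.neighborFinset x).erase v).card := by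
    have h1 := card_compl_insert_neighborFinset hd v
    have h2 := card_sigma_neighborFinset_erase hd v
    have h3 := Finset.card_image_le (f := fun p ↦ p.2)
      (s := (G.neighborFinset v).sigma fun x ↦ (G.neighborFinset x).erase v)
    have h4 : (insert v (G.neighborFinset v))ᶜ ⊆
        ((G.neighborFinset v).sigma fun x ↦ (G.neighborFinset x).erase v).image
        (fun p ↦ p.2) := by
      intro y hy
      simp only [Finset.mem_compl, Finset.mem_insert, mem_neighborFinset, not_or] at hy
      obtain ⟨x, hx, hxy⟩ := hm (Ne.symm hy.1) hy.2
      exact Finset.mem_image.2 ⟨⟨x, y⟩, by simp [hx, hxy, hy.1], rfl⟩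
    have h5 := Finset.card_le_card h4
    exact ⟨(Finset.eq_of_subset_of_card_le h4 (by omega)).symm, by omega⟩
  refine ⟨fun {a b c} hab hbc hac ↦ ?_, fun {a b x y} hab hax hxb hay hyb ↦ ?_, hm⟩
  · have := (key a).1.le (Finset.mem_image.2 ⟨⟨b, c⟩, by simp [hab, hbc, hac.ne'], rfl⟩)
    simp [hac] at this
  · have := Finset.card_image_iff.1 (key a).2 (x₁ := ⟨x, b⟩) (x₂ := ⟨y, b⟩)
      (by simp [hax, hxb, hab.symm]) (by simp [hay, hyb, hab.symm]) rfl
    simpa using this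

end Counting

lemma isRegularOfDegree_iff_ncard [Fintype V] [DecidableRel G.Adj] :
    G.IsRegularOfDegree d ↔ ∀ v, (G.neighborSet v).ncard = d := by
  refine forall_congr' fun v ↦ ?_
  rw [Set.ncard_eq_toFinset_card', ← neighborFinset_def, card_neighborFinset_eq_degree]

lemma mooreBound_two (d : ℕ) :
    1 + d * ∑ i ∈ Finset.range 2, (d - 1) ^ i = d * (d - 1) + (d + 1) := by
  simp [Finset.sum_range_succ]; ring

lemma ediam_eq_two_iff_exists : G.ediam = 2 ↔
    (∀ a b : V, a ≠ b → ¬ G.Adj a b → ∃ x, G.Adj a x ∧ G.Adj x b) ∧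
      ∃ a b : V, a ≠ b ∧ ¬ G.Adj a b := by
  have h1 : G.ediam ≤ 2 ↔ ∀ a b : V, a ≠ b → ¬ G.Adj a b → ∃ x, G.Adj a x ∧ G.Adj x b := by
    rw [ediam_le_iff]
    refine forall₂_congr fun a b ↦ ?_
    rw [← not_lt, two_lt_edist_iff, ← Set.not_nonempty_iff_eq_empty]
    simp only [Set.Nonempty, mem_commonNeighbors, G.adj_comm b, not_and, not_not]
  have h2 : 2 ≤ G.ediam ↔ ∃ a b : V, a ≠ b ∧ ¬ G.Adj a b := by
    rw [← not_lt, show G.ediam < 2 ↔ G.ediam ≤ 1 from ENat.lt_add_one_iff (n := 1) (by simp),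
      ediam_le_iff]
    simp only [edist_le_one_iff_adj_or_eq]
    push Not
    exact exists₂_congr fun _ _ ↦ and_comm
  rw [le_antisymm_iff, h1, h2]

/-- The nonadjacent pair excludes the complete graphs on at most two vertices, which meet the other
conditions for suitable `d`. -/
lemma isMooreGraph_two_iff [Fintype V] [DecidableRel G.Adj] : G.IsMooreGraph d 2 ↔
    G.IsGirthFiveDiamTwo ∧ G.IsRegularOfDegree d ∧ ∃ a b : V, a ≠ b ∧ ¬ G.Adj a b := by
  classical
  rw [IsMooreGraph, ← isRegularOfDegree_iff_ncard, mooreBound_two, Nat.card_eq_fintype_card,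
    Nat.cast_ofNat, ediam_eq_two_iff_exists]
  constructor
  · rintro ⟨h1, ⟨h2, h3⟩, h4⟩
    exact ⟨isGirthFiveDiamTwo_of_card h1 h4 (h2 _ _), h1, h3⟩
  · rintro ⟨h1, h2, h3⟩
    have : Nonempty V := ⟨h3.choose⟩
    exact ⟨h2, ⟨fun _ _ ↦ h1.exists_adj_adj, h3⟩, h1.card_eq h2⟩

lemma IsGirthFiveDiamTwo.two_le_degree [Fintype V] [DecidableRel G.Adj]
    (h : G.IsGirthFiveDiamTwo) (hd : G.IsRegularOfDegree d) (hne : ∃ a b : V, a ≠ b ∧ ¬ G.Adj a b) :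
    2 ≤ d := by
  classical
  obtain ⟨a, b, hab, hn⟩ := hne
  obtain ⟨x, hax, hxb⟩ := h.exists_adj_adj hab hn
  rw [← hd x, ← card_neighborFinset_eq_degree, ← Finset.card_pair hab]
  exact Finset.card_le_card (by
    intro y
    simp only [Finset.mem_insert, Finset.mem_singleton, mem_neighborFinset]
    rintro (rfl | rfl)
    exacts [hax.symm, hxb])

lemma IsGirthFiveDiamTwo.connected [Nonempty V] (h : G.IsGirthFiveDiamTwo) : G.Connected := by
  refine ⟨fun a b ↦ ?_⟩
  by_cases hab : a = b
  · exact hab ▸ Reachable.refl a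
  by_cases hn : G.Adj a b
  · exact hn.reachable
  · obtain ⟨x, hx, hxb⟩ := h.exists_adj_adj hab hn
    exact hx.reachable.trans hxb.reachable

lemma IsGirthFiveDiamTwo.dist_le_two [Nonempty V] (h : G.IsGirthFiveDiamTwo) (a b : V) :
    G.dist a b ≤ 2 := by
  by_cases hab : a = b
  · simp [hab]
  by_cases hn : G.Adj a b
  · simp [dist_eq_one_iff_adj.2 hn]
  · obtain ⟨x, hx, hxb⟩ := h.exists_adj_adj hab hn
    exact dist_le (Walk.cons hx (Walk.cons hxb Walk.nil))

/-- Balls of radius at least two are everything. In a ball of radius one, two distinct nonadjacent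
members are neighbors of the center, which is their only common neighbor. -/
lemma IsGirthFiveDiamTwo.isCBGraph [Nonempty V] (h : G.IsGirthFiveDiamTwo) : G.IsCBGraph := by
  refine ⟨h.connected, fun v r hr ↦ ?_⟩
  rcases hr.lt_or_eq with hr | rfl
  · exact fun _ _ _ _ x _ ↦ (h.dist_le_two v x).trans hr
  intro u hu w hw x hx
  simp only [distBall, Set.mem_ofPred_eq, distInterval] at *
  have hc := h.connected
  have key (y : V) : G.dist v y ≤ 1 ↔ v = y ∨ G.Adj v y := by
    rw [Nat.le_one_iff_eq_zero_or_eq_one, hc.dist_eq_zero_iff, dist_eq_one_iff_adj]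
  by_cases hxu : u = x
  · exact hxu ▸ hu
  by_cases hxw : x = w
  · exact hxw ▸ hw
  have h1 := hc.pos_dist_of_ne hxu
  have h2 := hc.pos_dist_of_ne hxw
  have h3 := h.dist_le_two u w
  have hux : G.Adj u x := dist_eq_one_iff_adj.1 (by omega)
  have hxw' : G.Adj x w := dist_eq_one_iff_adj.1 (by omega)
  have huw : u ≠ w := by rintro rfl; simp at hx; omega
  have hn : ¬ G.Adj u w := fun hh ↦ by rw [dist_eq_one_iff_adj.2 hh] at hx; omega
  rw [key] at hu hw ⊢
  left
  rcases hu with rfl | hu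
  · rcases hw with rfl | hw
    · exact absurd rfl huw
    · exact absurd hw hn
  · rcases hw with rfl | hw
    · exact absurd hu.symm hn
    · exact h.eq_of_adj huw hu.symm hw hux hxw'

lemma IsGirthFiveDiamTwo.cliqueFree (h : G.IsGirthFiveDiamTwo) : G.CliqueFree 3 := by
  classical
  intro s hs
  obtain ⟨a, b, c, hab, hac, hbc, -⟩ := is3Clique_iff.1 hs
  exact h.not_adj hab hbc hac

lemma IsGirthFiveDiamTwo.isTwoConnected [Fintype V] [DecidableRel G.Adj]
    (h : G.IsGirthFiveDiamTwo) (hd : G.IsRegularOfDegree d) (hne : ∃ a b : V, a ≠ b ∧ ¬ G.Adj a b) :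
    G.IsTwoConnected := by
  classical
  have h2 := h.two_le_degree hd hne
  have : Nonempty V := ⟨hne.choose⟩
  refine ⟨?_, h.connected, fun v ↦ ?_⟩
  · have := h.card_eq hd
    rw [Nat.card_eq_fintype_card]; omega
  · rintro ⟨x, hx⟩ ⟨y, hy⟩
    simp only [Set.mem_ofPred_eq] at hx hy
    have hadj {x y : V} (hx : x ≠ v) (hy : y ≠ v) (hxy : G.Adj x y) :
        (G.induce {w | w ≠ v}).Reachable ⟨x, hx⟩ ⟨y, hy⟩ := Adj.reachable (by simpa using hxy)
    by_cases hxy : x = y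
    · subst hxy; exact Reachable.refl _
    by_cases hn : G.Adj x y
    · exact hadj hx hy hn
    obtain ⟨z, hxz, hzy⟩ := h.exists_adj_adj hxy hn
    -- If the deleted vertex is the middle of the only short path, a detour through another neighbor
    -- `x'` of `x` and the common neighbor of `x'` and `y` avoids it.
    by_cases hz : z = v
    · subst hz
      obtain ⟨x', hx', hx'z⟩ : ∃ x', G.Adj x x' ∧ x' ≠ z := by
        have hc : 1 < (G.neighborFinset x).card := by
          rw [card_neighborFinset_eq_degree, hd x]; omega
        obtain ⟨x', h1, h2⟩ := Finset.exists_mem_ne hc z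
        exact ⟨x', by simpa using h1, h2⟩
      have hx'n : ¬ G.Adj x' z := fun hh ↦ h.not_adj hx' hh hxz
      have hne : x' ≠ y := fun hh ↦ hn (hh ▸ hx')
      have hx'y : ¬ G.Adj x' y := fun hh ↦ hx'z (h.eq_of_adj hxy hx' hh hxz hzy)
      obtain ⟨p, hp, hpy⟩ := h.exists_adj_adj hne hx'y
      have hpz : p ≠ z := fun hh ↦ hx'n (hh ▸ hp)
      exact ((hadj hx hx'z hx').trans (hadj hx'z hpz hp)).trans (hadj hpz hy hpy)
    · exact (hadj hx hz hxz).trans (hadj hz hy hzy)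

end SimpleGraph

/-! ### Triangle-free CB-graphs without cut vertices have diameter at most two -/

namespace SimpleGraph

variable {V : Type*} {G : SimpleGraph V}

/-- A triangle-free graph with convex balls. -/
structure IsTriangleFreeCB (G : SimpleGraph V) : Prop where
  connected : G.Connected
  convex : ∀ (v : V) (r : ℕ), 1 ≤ r → G.IsGeodesicallyConvex (G.distBall v r)
  not_adj : ∀ {a b c : V}, G.Adj a b → G.Adj b c → ¬ G.Adj a c

lemma not_adj_of_cliqueFree (h : G.CliqueFree 3) {a b c : V} (hab : G.Adj a b) (hbc : G.Adj b c) :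
    ¬ G.Adj a c := by
  classical
  exact fun hac ↦ h {a, b, c} (is3Clique_triple_iff.2 ⟨hab, hac, hbc⟩)

lemma IsCBGraph.isTriangleFreeCB (h : G.IsCBGraph) (ht : G.CliqueFree 3) : G.IsTriangleFreeCB :=
  ⟨h.1, h.2, not_adj_of_cliqueFree ht⟩

namespace IsTriangleFreeCB

variable (h : G.IsTriangleFreeCB)

include h

lemma dist_eq_two {a x b : V} (hax : G.Adj a x) (hxb : G.Adj x b) (hab : a ≠ b) :
    G.dist a b = 2 := by
  have h1 := h.connected.one_lt_dist_of_ne_of_not_adj hab (h.not_adj hax hxb)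
  have h2 := dist_le (Walk.cons hax (Walk.cons hxb Walk.nil))
  simp at h2; omega

lemma dist_le_add_one {v a b : V} (hab : G.Adj a b) : G.dist v b ≤ G.dist v a + 1 := by
  have := h.connected.dist_triangle (u := v) (v := a) (w := b)
  rwa [dist_eq_one_iff_adj.2 hab] at this

lemma dist_le_of_geodesic {v a b x : V} {r : ℕ} (hr : 1 ≤ r) (ha : G.dist v a ≤ r)
    (hb : G.dist v b ≤ r) (hx : G.dist a b = G.dist a x + G.dist x b) : G.dist v x ≤ r :=
  h.convex v r hr a ha b hb hx

lemma dist_le_of_adj_adj {v a b x : V} {r : ℕ} (hr : 1 ≤ r) (ha : G.dist v a ≤ r)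
    (hb : G.dist v b ≤ r) (hab : a ≠ b) (hax : G.Adj a x) (hxb : G.Adj x b) : G.dist v x ≤ r :=
  h.dist_le_of_geodesic hr ha hb
    (by rw [h.dist_eq_two hax hxb hab, dist_eq_one_iff_adj.2 hax, dist_eq_one_iff_adj.2 hxb])

/-- If `x ≠ y`, then `s` lies on a geodesic between them but outside the ball around `v` that
contains both. Radius zero is treated apart, as only balls of positive radius are known to be
convex. -/
lemma eq_of_dist_add_one {v s x y : V} (hx : G.Adj x s) (hy : G.Adj y s)
    (hvx : G.dist v x + 1 = G.dist v s) (hvy : G.dist v y + 1 = G.dist v s) : x = y := by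
  by_contra hxy
  rcases Nat.eq_zero_or_pos (G.dist v x) with h0 | h0
  · have h1 : G.dist v y = 0 := by omega
    exact hxy ((h.connected.dist_eq_zero_iff.1 h0).symm.trans (h.connected.dist_eq_zero_iff.1 h1))
  · have := h.dist_le_of_adj_adj (v := v) (r := G.dist v x) h0 le_rfl (by omega) hxy hx hy.symm
    omega

lemma eq_of_adj {a b x y : V} (hab : a ≠ b) (hax : G.Adj a x) (hxb : G.Adj x b) (hay : G.Adj a y)
    (hyb : G.Adj y b) : x = y :=
  h.eq_of_dist_add_one hxb hyb
    (by rw [h.dist_eq_two hax hxb hab, dist_eq_one_iff_adj.2 hax])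
    (by rw [h.dist_eq_two hax hxb hab, dist_eq_one_iff_adj.2 hay])

lemma exists_adj_dist_eq {v s : V} {k : ℕ} (hs : G.dist v s = k + 1) :
    ∃ p, G.Adj p s ∧ G.dist v p = k := by
  obtain ⟨w, hw⟩ := h.connected.exists_walk_length_eq_dist s v
  cases w with
  | nil => simp at hs
  | @cons _ p _ hsp w =>
    have h1 := dist_le w
    have h2 := h.dist_le_add_one (v := v) hsp.symm
    rw [Walk.length_cons, dist_comm] at hw
    rw [dist_comm] at h1
    exact ⟨p, hsp.symm, by omega⟩

lemma exists_adj_adj_of_dist_eq_two {a b : V} (hab : G.dist a b = 2) :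
    ∃ x, G.Adj a x ∧ G.Adj x b := by
  obtain ⟨x, hx, hax⟩ := h.exists_adj_dist_eq hab
  exact ⟨x, dist_eq_one_iff_adj.1 hax, hx⟩

/-- At distance three, `m` and `b` would be two different predecessors of `n` as seen from `x`. -/
lemma dist_le_two_of_two_walks {x p m n a b : V} (hxp : G.Adj x p) (hpm : G.Adj p m)
    (hmn : G.Adj m n) (hxa : G.Adj x a) (hab : G.Adj a b) (hbn : G.Adj b n) (hmb : m ≠ b) :
    G.dist x n ≤ 2 := by
  have h1 := dist_le (Walk.cons hxp (Walk.cons hpm Walk.nil))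
  have h2 := dist_le (Walk.cons hxa (Walk.cons hab Walk.nil))
  have h3 := h.dist_le_add_one (v := x) hmn
  have h4 := h.dist_le_add_one (v := x) hbn
  simp only [Walk.length_cons, Walk.length_nil] at h1 h2
  by_contra hn
  exact hmb (h.eq_of_dist_add_one hmn hbn (v := x) (by omega) (by omega))

omit h in
lemma dist_le_two_of_adj_adj {a x b : V} (hax : G.Adj a x) (hxb : G.Adj x b) : G.dist a b ≤ 2 :=
  dist_le (Walk.cons hax (Walk.cons hxb Walk.nil))

/-- The pentagon condition: a horizontal edge closes up to a pentagon two levels below. -/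
lemma pentagon_condition (k : ℕ) : ∀ {v u w : V}, G.dist v u = k → G.dist v w = k → G.Adj u w →
    ∃ u' z w', G.Adj u' u ∧ G.Adj z u' ∧ G.Adj z w' ∧ G.Adj w' w ∧ G.dist v z + 2 = k ∧
      G.dist v u' + 1 = k ∧ G.dist v w' + 1 = k := by
  induction k using Nat.strong_induction_on with
  | _ k ih =>
  intro v u w hu hw huw
  match k, ih, hu, hw with
  | 0, _, hu, hw =>
    rw [h.connected.dist_eq_zero_iff] at hu hw
    exact absurd (hu.symm.trans hw) huw.ne
  | 1, _, hu, hw =>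
    rw [dist_eq_one_iff_adj] at hu hw
    exact absurd hw (h.not_adj hu huw)
  | n + 2, ih, hu, hw =>
    obtain ⟨u', hu'u, hu'⟩ := h.exists_adj_dist_eq hu
    obtain ⟨w', hw'w, hw'⟩ := h.exists_adj_dist_eq hw
    have hne : u' ≠ w' := by rintro rfl; exact h.not_adj hu'u huw hw'w
    have huw' : u ≠ w' := by rintro rfl; omega
    have hu'w : u' ≠ w := by rintro rfl; omega
    -- At distance three, `u` would lie between `u'` and `w'`, both in the ball of radius `n + 1`.
    have hd3 : G.dist u' w' ≠ 3 := by
      intro hd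
      have := h.dist_le_of_geodesic (v := v) (a := u') (b := w') (x := u) (r := n + 1) (by omega)
        (by omega) (by omega)
        (by rw [h.dist_eq_two huw hw'w.symm huw', dist_eq_one_iff_adj.2 hu'u, hd])
      omega
    have hd1 : G.dist u' w' ≠ 1 := by
      rw [Ne, dist_eq_one_iff_adj]
      exact fun hd ↦ huw' (h.eq_of_adj hu'w hu'u huw hd hw'w)
    have hd0 : G.dist u' w' ≠ 0 := by rwa [Ne, h.connected.dist_eq_zero_iff]
    have hdle : G.dist u' w' ≤ 3 :=
      dist_le (Walk.cons hu'u (Walk.cons huw (Walk.cons hw'w.symm Walk.nil)))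
    obtain ⟨z, hu'z, hzw'⟩ := h.exists_adj_adj_of_dist_eq_two (show G.dist u' w' = 2 by omega)
    have hz := h.dist_le_of_adj_adj (v := v) (r := n + 1) (by omega) hu'.le hw'.le hne hu'z hzw'
    have hz' := h.dist_le_add_one (v := v) hu'z.symm
    rcases (show G.dist v z = n ∨ G.dist v z = n + 1 by omega) with hzn | hzn
    · exact ⟨u', z, w', hu'u, hu'z.symm, hzw', hw'w, by omega, by omega, by omega⟩
    -- Now `z` is on the level of `u'` and `w'`. Induction applies to both edges at `z`; uniqueness
    -- of predecessors merges the two apexes into one vertex `t`, adjacent to `u''` and `w''`. This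
    -- brings `w''` close to `u'`, then to `u`, and ends in a quadrangle.
    exfalso
    obtain ⟨u'', t, z₁, hu''u', htu'', htz₁, hz₁z, ht, hu'', hz₁⟩ :=
      ih (n + 1) (by omega) hu' hzn hu'z
    obtain ⟨z₂, t', w'', hz₂z, ht'z₂, ht'w'', hw''w', ht', hz₂, hw''⟩ :=
      ih (n + 1) (by omega) hzn hw' hzw'
    obtain rfl := h.eq_of_dist_add_one (v := v) hz₁z hz₂z (by omega) (by omega)
    obtain rfl := h.eq_of_dist_add_one (v := v) htz₁ ht'z₂ (by omega) (by omega)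
    have h1 : G.dist w'' u' ≤ 2 := h.dist_le_two_of_two_walks hw''w' hzw'.symm hu'z.symm
      ht'w''.symm htu'' hu''u' (by rintro rfl; omega)
    have h2 : G.dist w'' u ≤ 2 := h.dist_le_of_adj_adj (by norm_num) h1
      (dist_le_two_of_adj_adj hw''w' hw'w) hu'w hu'u huw
    have h3 := h.connected.dist_triangle (u := v) (v := w'') (w := u)
    obtain ⟨q, hw''q, hqu⟩ := h.exists_adj_adj_of_dist_eq_two (show G.dist w'' u = 2 by omega)
    have h4 := h.dist_le_add_one (v := v) hw''q
    have h5 := h.dist_le_add_one (v := v) hqu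
    obtain rfl := h.eq_of_dist_add_one (v := v) hqu hu'u (by omega) (by omega)
    exact hne (h.eq_of_adj (a := w'') (b := z) (by rintro rfl; omega) hw''q hu'z hw''w' hzw'.symm)

lemma dist_le_two_of_path {a x p m n : V} (hax : G.Adj a x) (hxp : G.Adj x p) (hpm : G.Adj p m)
    (hmn : G.Adj m n) (hm : G.dist a m = 2) (hn : G.dist a n = 2) : G.dist x n ≤ 2 := by
  obtain ⟨b, hab, hbn⟩ := h.exists_adj_adj_of_dist_eq_two hn
  refine h.dist_le_two_of_two_walks hxp hpm hmn hax.symm hab hbn ?_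
  rintro rfl
  rw [dist_eq_one_iff_adj.2 hab] at hm
  omega

lemma eq_or_adj_or_exists_of_dist_le_two {a b : V} (hab : G.dist a b ≤ 2) :
    a = b ∨ G.Adj a b ∨ ∃ x, G.Adj a x ∧ G.Adj x b := by
  rcases (show G.dist a b = 0 ∨ G.dist a b = 1 ∨ G.dist a b = 2 by omega) with h0 | h0 | h0
  · exact .inl (h.connected.dist_eq_zero_iff.1 h0)
  · exact .inr (.inl (dist_eq_one_iff_adj.1 h0))
  · exact .inr (.inr (h.exists_adj_adj_of_dist_eq_two h0))

lemma dist_le_two_of_horizontal {a x m n : V} (hax : G.Adj a x) (hxm : G.dist x m ≤ 2)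
    (hmn : G.Adj m n) (hm : G.dist a m = 2) (hn : G.dist a n = 2) : G.dist x n ≤ 2 := by
  rcases h.eq_or_adj_or_exists_of_dist_le_two hxm with rfl | h1 | ⟨p, hxp, hpm⟩
  · rw [dist_eq_one_iff_adj.2 hax] at hm; omega
  · exact dist_le_two_of_adj_adj h1 hmn
  · exact h.dist_le_two_of_path hax hxp hpm hmn hm hn

/-- The middle vertex of a path from `x'` to `n` is `x` itself if it is on level one. On level two
the path lemma applies, and on level three unique predecessors force `x' = n`. -/
lemma dist_le_two_of_child {a x x' n : V} (hax : G.Adj a x) (hxx' : G.Adj x x')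
    (hx' : G.dist a x' = 2) (hn : G.dist a n = 2) (hx'n : G.dist x' n ≤ 2) : G.dist x n ≤ 2 := by
  have hx1 := dist_eq_one_iff_adj.2 hax
  rcases h.eq_or_adj_or_exists_of_dist_le_two hx'n with rfl | h1 | ⟨q, hx'q, hqn⟩
  · rw [dist_eq_one_iff_adj.2 hxx']; norm_num
  · exact dist_le_two_of_adj_adj hxx' h1
  · have h1 := h.dist_le_add_one (v := a) hx'q
    have h2 := h.dist_le_add_one (v := a) hx'q.symm
    rcases (show G.dist a q = 1 ∨ G.dist a q = 2 ∨ G.dist a q = 3 by omega) with h0 | h0 | h0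
    · obtain rfl := h.eq_of_dist_add_one (v := a) hx'q.symm hxx' (by omega) (by omega)
      rw [dist_eq_one_iff_adj.2 hqn]; norm_num
    · exact h.dist_le_two_of_path hax hxx' hx'q hqn h0 hn
    · obtain rfl := h.eq_of_dist_add_one (v := a) hx'q hqn.symm (by omega) (by omega)
      rw [dist_eq_one_iff_adj.2 hxx']; norm_num

lemma dist_eq_two_of_pentagon {a x x' y' y : V} (hax : G.Adj a x) (hay : G.Adj a y)
    (hxx' : G.Adj x x') (hx'y' : G.Adj x' y') (hy'y : G.Adj y' y) :
    G.dist a x' = 2 :=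
  h.dist_eq_two hax hxx' (by rintro rfl; exact h.not_adj hx'y' hy'y hay)

/-- Two pentagons through `a` that share the edge `a y` lie close to each other. -/
lemma dist_le_two_of_two_pentagons {a x x' y' y y'' z'' z : V} (hax : G.Adj a x) (hay : G.Adj a y)
    (haz : G.Adj a z) (hxy : x ≠ y) (hyz : y ≠ z) (hxx' : G.Adj x x') (hx'y' : G.Adj x' y')
    (hy'y : G.Adj y' y) (hyy'' : G.Adj y y'') (hy''z'' : G.Adj y'' z'') (hz''z : G.Adj z'' z) :
    G.dist x y'' ≤ 2 := by
  have hx1 := dist_eq_one_iff_adj.2 hax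
  have hy1 := dist_eq_one_iff_adj.2 hay
  have hz1 := dist_eq_one_iff_adj.2 haz
  have hx' := h.dist_eq_two_of_pentagon hax hay hxx' hx'y' hy'y
  have hy'' := h.dist_eq_two_of_pentagon hay haz hyy'' hy''z'' hz''z
  have hz'' := h.dist_eq_two_of_pentagon haz hay hz''z.symm hy''z''.symm hyy''.symm
  by_contra hcon
  -- If `x` is far from `y''`, then `x` and `x'` are both far from `y''` and `z''`. So `y''` and
  -- `z''` are at distance exactly three from `x'`, where the pentagon condition can be used.
  have hxz'' : ¬ G.dist x z'' ≤ 2 := fun hh ↦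
    hcon (h.dist_le_two_of_horizontal hax hh hy''z''.symm hz'' hy'')
  have hx'y'' : ¬ G.dist x' y'' ≤ 2 := fun hh ↦
    hcon (h.dist_le_two_of_child hax hxx' hx' hy'' hh)
  have hx'z'' : ¬ G.dist x' z'' ≤ 2 := fun hh ↦
    hxz'' (h.dist_le_two_of_child hax hxx' hx' hz'' hh)
  have h1 : G.dist x' y'' ≤ 3 :=
    dist_le (Walk.cons hx'y' (Walk.cons hy'y (Walk.cons hyy'' Walk.nil)))
  have h2 : G.dist x' z ≤ 3 :=
    dist_le (Walk.cons hxx'.symm (Walk.cons hax.symm (Walk.cons haz Walk.nil)))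
  have h3 : G.dist x' z'' ≤ 3 := h.dist_le_of_adj_adj (by norm_num) h1 h2
    (by rintro rfl; omega) hy''z'' hz''z
  have hx'x := dist_eq_one_iff_adj.2 hxx'.symm
  have hx'a : G.dist x' a = 2 := by rw [dist_comm, hx']
  -- The edge `z'' z` is horizontal as seen from `x'` in the first case, and `z'' y''` in the
  -- second, where `z` is the predecessor of `z''`.
  by_cases h4 : G.dist x' z = 3
  · obtain ⟨z₃, t, z₁, hz₃z'', htz₃, htz₁, hz₁z, ht, hz₃, hz₁⟩ :=
      h.pentagon_condition 3 (show G.dist x' z'' = 3 by omega) h4 hz''z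
    obtain rfl := h.eq_of_dist_add_one (v := x') hz₁z haz (by omega) (by omega)
    obtain rfl := h.eq_of_dist_add_one (v := x') htz₁ hax.symm (by omega) (by omega)
    exact hxz'' (dist_le_two_of_adj_adj htz₃ hz₃z'')
  · have h5 := h.dist_le_add_one (v := x') hz''z.symm
    obtain ⟨z₁, t, r, hz₁z'', htz₁, htr, hry'', ht, hz₁, hr⟩ :=
      h.pentagon_condition 3 (show G.dist x' z'' = 3 by omega) (show G.dist x' y'' = 3 by omega)
        hy''z''.symm
    obtain rfl := h.eq_of_dist_add_one (v := x') hz₁z'' hz''z.symm (by omega) (by omega)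
    have hat : G.dist a t = 2 := h.dist_eq_two haz htz₁.symm (by rintro rfl; omega)
    have h6 := h.dist_le_add_one (v := a) htr
    have h7 := h.dist_le_add_one (v := a) htr.symm
    rcases (show G.dist a r = 1 ∨ G.dist a r = 2 ∨ G.dist a r = 3 by omega) with h0 | h0 | h0
    · obtain rfl := h.eq_of_dist_add_one (v := a) htr.symm htz₁.symm (by omega) (by omega)
      exact hyz (h.eq_of_dist_add_one (v := a) hyy'' hry'' (by omega) (by omega))
    · have h8 := h.dist_le_two_of_path hax hxx' (dist_eq_one_iff_adj.1 (show G.dist x' t = 1 by omega))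
        htr hat h0
      exact hcon (h.dist_le_two_of_horizontal hax h8 hry'' h0 hy'')
    · obtain rfl := h.eq_of_dist_add_one (v := a) htr hry''.symm (by omega) (by omega)
      exact hyz (h.eq_of_dist_add_one (v := a) hyy'' htz₁.symm (by omega) (by omega))

omit h in
/-- `x` and `y` are equal or joined by a path of length three, so that two distinct neighbors
of `a` with this property lie in a pentagon with `a`. -/
def EqOrPath (G : SimpleGraph V) (x y : V) : Prop :=
  x = y ∨ ∃ x' y', G.Adj x x' ∧ G.Adj x' y' ∧ G.Adj y' y

lemma eqOrPath_trans {a x y z : V} (hax : G.Adj a x) (hay : G.Adj a y) (haz : G.Adj a z)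
    (hxy : EqOrPath G x y) (hyz : EqOrPath G y z) : EqOrPath G x z := by
  by_cases hxz : x = z
  · exact .inl hxz
  by_cases hxy0 : x = y
  · exact hxy0 ▸ hyz
  by_cases hyz0 : y = z
  · exact hyz0 ▸ hxy
  obtain ⟨x', y', hxx', hx'y', hy'y⟩ := hxy.resolve_left hxy0
  obtain ⟨y'', z'', hyy'', hy''z'', hz''z⟩ := hyz.resolve_left hyz0
  have h1 := h.dist_le_two_of_two_pentagons hax hay haz hxy0 hyz0 hxx' hx'y' hy'y hyy'' hy''z'' hz''z
  have hy'' := h.dist_eq_two_of_pentagon hay haz hyy'' hy''z'' hz''z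
  have hz'' := h.dist_eq_two_of_pentagon haz hay hz''z.symm hy''z''.symm hyy''.symm
  have hx1 := dist_eq_one_iff_adj.2 hax
  have hz1 := dist_eq_one_iff_adj.2 haz
  rcases h.eq_or_adj_or_exists_of_dist_le_two
    (h.dist_le_two_of_horizontal hax h1 hy''z'' hy'' hz'') with rfl | h0 | ⟨p, hxp, hpz⟩
  · omega
  · exact absurd (h.eq_of_dist_add_one (v := a) h0 hz''z.symm (by omega) (by omega)) hxz
  · exact .inr ⟨p, z'', hxp, hpz, hz''z⟩

lemma exists_branch {a s : V} (hs : s ≠ a) : ∃ b, G.Adj a b ∧ G.dist a s = G.dist b s + 1 := by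
  have h0 := h.connected.pos_dist_of_ne hs
  obtain ⟨b, hb, hd⟩ := h.exists_adj_dist_eq (show G.dist s a = (G.dist s a - 1) + 1 by omega)
  exact ⟨b, hb.symm, by rw [G.dist_comm (u := a), G.dist_comm (u := b), hd]; omega⟩

lemma branch_unique {a s b c : V} (hb : G.Adj a b) (hc : G.Adj a c)
    (hbs : G.dist a s = G.dist b s + 1) (hcs : G.dist a s = G.dist c s + 1) : b = c := by
  rw [dist_comm, G.dist_comm (u := b)] at hbs
  rw [dist_comm, G.dist_comm (u := c)] at hcs
  exact h.eq_of_dist_add_one hb.symm hc.symm hbs.symm hcs.symm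

/-- An edge between different levels stays in one branch. A horizontal edge closes to a pentagon: if
the apex is `a`, this is the wanted pentagon; otherwise both ends lie in the branch of the apex. -/
lemma eqOrPath_branch {a s t b c : V} (hst : G.Adj s t) (hb : G.Adj a b) (hc : G.Adj a c)
    (hbs : G.dist a s = G.dist b s + 1) (hct : G.dist a t = G.dist c t + 1) :
    EqOrPath G b c := by
  have h1 := h.dist_le_add_one (v := a) hst
  have h2 := h.dist_le_add_one (v := a) hst.symm
  have h3 := h.dist_le_add_one (v := b) hst
  have h4 := h.dist_le_add_one (v := c) hst.symm
  have tri {e u : V} (he : G.Adj a e) : G.dist a u ≤ 1 + G.dist e u := by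
    have := h.connected.dist_triangle (u := a) (v := e) (w := u)
    rwa [dist_eq_one_iff_adj.2 he] at this
  rcases (show G.dist a t = G.dist a s + 1 ∨ G.dist a s = G.dist a t + 1 ∨
    G.dist a s = G.dist a t by omega) with h0 | h0 | h0
  · have := tri (u := t) hb
    exact .inl (h.branch_unique hb hc (s := t) (by omega) hct)
  · have := tri (u := s) hc
    exact .inl (h.branch_unique hb hc (s := s) hbs (by omega))
  · obtain ⟨s', z, t', hs's, hzs', hzt', ht't, hz, hs', ht'⟩ := h.pentagon_condition _ h0 rfl hst
    by_cases hza : z = a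
    · subst hza
      rw [dist_self] at hz
      have e1 := dist_eq_one_iff_adj.2 hs's
      have e2 := dist_eq_one_iff_adj.2 ht't
      obtain rfl := h.branch_unique hb hzs' (s := s) hbs (by omega)
      obtain rfl := h.branch_unique hc hzt' (s := t) hct (by omega)
      exact .inr ⟨s, t, hs's, hst, ht't.symm⟩
    · obtain ⟨e, he, hez⟩ := h.exists_branch hza
      have e1 := h.dist_le_add_one (v := e) hzs'
      have e2 := h.dist_le_add_one (v := e) hs's
      have e3 := h.dist_le_add_one (v := e) hzt'
      have e4 := h.dist_le_add_one (v := e) ht't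
      have e5 := tri (u := s) he
      have e6 := tri (u := t) he
      obtain rfl := h.branch_unique hb he (s := s) hbs (by omega)
      exact .inl (h.branch_unique he hc (s := t) (by omega) hct)

/-- If `a` is not a cut vertex, then any two neighbors of `a` lie in a pentagon with `a`. -/
lemma exists_pentagon {a x y : V} (ha : (G.induce {w | w ≠ a}).Preconnected) (hx : G.Adj a x)
    (hy : G.Adj a y) (hxy : x ≠ y) : ∃ x' y', G.Adj x x' ∧ G.Adj x' y' ∧ G.Adj y' y := by
  have key (s t : {w | w ≠ a}) (p : (G.induce {w | w ≠ a}).Walk s t)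
      (hs : ∃ b, G.Adj a b ∧ G.dist a s = G.dist b s + 1 ∧ EqOrPath G x b) :
      ∃ b, G.Adj a b ∧ G.dist a t = G.dist b t + 1 ∧ EqOrPath G x b := by
    induction p with
    | nil => exact hs
    | @cons s u t hsu p ih =>
      obtain ⟨b, hb, hbs, hxb⟩ := hs
      obtain ⟨c, hc, hcu⟩ := h.exists_branch u.2
      exact ih ⟨c, hc, hcu, h.eqOrPath_trans hx hb hc hxb
        (h.eqOrPath_branch (by simpa using hsu) hb hc hbs hcu)⟩
  obtain ⟨p⟩ := ha ⟨x, hx.ne'⟩ ⟨y, hy.ne'⟩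
  obtain ⟨b, hb, hby, hxb⟩ := key _ _ p
    ⟨x, hx, by simp [dist_eq_one_iff_adj.2 hx], .inl rfl⟩
  obtain rfl := h.branch_unique hb hy (s := y) hby (by simp [dist_eq_one_iff_adj.2 hy])
  exact hxb.resolve_left hxy

lemma exists_dist_eq_three {v w : V} (k : ℕ) (hk : G.dist v w = k + 3) :
    ∃ w, G.dist v w = 3 := by
  induction k generalizing w with
  | zero => exact ⟨w, hk⟩
  | succ k ih =>
    obtain ⟨p, -, hp⟩ := h.exists_adj_dist_eq (v := v) (s := w) (k := k + 3) (by omega)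
    exact ih hp

lemma isGirthFiveDiamTwo (hns : ∀ v : V, (G.induce {w | w ≠ v}).Preconnected) :
    G.IsGirthFiveDiamTwo := by
  refine ⟨h.not_adj, h.eq_of_adj, fun {v w} hvw hn ↦ ?_⟩
  have h1 := h.connected.one_lt_dist_of_ne_of_not_adj hvw hn
  by_cases h2 : G.dist v w = 2
  · exact h.exists_adj_adj_of_dist_eq_two h2
  exfalso
  obtain ⟨w, hw⟩ := h.exists_dist_eq_three (v := v) (w := w) (G.dist v w - 3) (by omega)
  obtain ⟨q, hqw, hq⟩ := h.exists_adj_dist_eq hw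
  obtain ⟨p, hpq, hp⟩ := h.exists_adj_dist_eq hq
  have hvp := dist_eq_one_iff_adj.1 hp
  have hvq : v ≠ q := by rintro rfl; simp at hq
  have hpw : p ≠ w := by rintro rfl; omega
  obtain ⟨v', q', hvv', hv'q', hq'q⟩ := h.exists_pentagon (hns p) hvp.symm hpq hvq
  obtain ⟨p', w', hpp', hp'w', hw'w⟩ := h.exists_pentagon (hns q) hpq.symm hqw hpw
  -- Both pentagons pass through `p` and share the edge `p q`; the second one contains `w`.
  have := h.dist_le_two_of_two_pentagons hvp.symm hpq hpp' hvq
    (by rintro rfl; exact h.not_adj hp'w' hw'w hqw) hvv' hv'q' hq'q hqw hw'w.symm hp'w'.symm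
  omega

end IsTriangleFreeCB

/-! ### Regularity and the characterization of Moore graphs -/

lemma IsGirthFiveDiamTwo.degree_le_degree [Fintype V] [DecidableRel G.Adj]
    (h : G.IsGirthFiveDiamTwo) {x y : V} (hxy : x ≠ y) (hn : ¬ G.Adj x y) :
    G.degree x ≤ G.degree y := by
  classical
  -- Sending `x'` to such a `y'` is injective: a collision gives a triangle, or a second common
  -- neighbor of two neighbors of `x`.
  have key (x' : V) (hx' : G.Adj x x') : ∃ y', G.Adj y y' ∧ (y' = x' ∨ G.Adj x' y') := by
    by_cases hx'y : G.Adj x' y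
    · exact ⟨x', hx'y.symm, .inl rfl⟩
    · obtain ⟨z, hz, hzy⟩ := h.exists_adj_adj (by rintro rfl; exact hn hx') hx'y
      exact ⟨z, hzy.symm, .inr hz⟩
  choose! f hf hf' using key
  rw [← card_neighborFinset_eq_degree, ← card_neighborFinset_eq_degree]
  refine Finset.card_le_card_of_injOn f (fun x' hx' ↦ ?_) (fun x₁ hx₁ x₂ hx₂ h12 ↦ ?_)
  · simpa using hf x' (by simpa using hx')
  · simp only [coe_neighborFinset, mem_neighborSet] at hx₁ hx₂
    have h1 := hf' x₁ hx₁
    have h2 := hf' x₂ hx₂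
    have h3 := hf x₁ hx₁
    rw [h12] at h1 h3
    by_contra hne
    rcases h1 with h1 | h1 <;> rcases h2 with h2 | h2
    · exact hne (h1.symm.trans h2)
    · exact h.not_adj hx₂ h2 (by rwa [h1])
    · exact h.not_adj hx₁ h1 (by rwa [h2])
    · have := h.eq_of_adj hne hx₁.symm hx₂ h1 h2.symm
      exact hn (this ▸ h3.symm)

lemma IsTriangleFreeCB.exists_isMooreGraph [Finite V] (h : G.IsTriangleFreeCB)
    (h2 : G.IsTwoConnected) : ∃ d, G.IsMooreGraph d 2 := by
  classical
  have := Fintype.ofFinite V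
  have hm := h.isGirthFiveDiamTwo h2.2.2
  have hcard : 2 < (Finset.univ : Finset V).card := by
    have := h2.1
    rw [Nat.card_eq_fintype_card] at this
    rw [Finset.card_univ]; omega
  have hdeg {x y : V} (hxy : x ≠ y) (hn : ¬ G.Adj x y) : G.degree x = G.degree y :=
    le_antisymm (hm.degree_le_degree hxy hn)
      (hm.degree_le_degree hxy.symm (fun hh ↦ hn hh.symm))
  have hdeg' {x y w : V} (hxy : G.Adj x y) (hxw : G.Adj x w) (hyw : y ≠ w) :
      G.degree x = G.degree y := by
    -- The vertex `w'` of this pentagon is nonadjacent to both `x` and `y`, so their degrees are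
    -- compared through it.
    obtain ⟨y', w', hyy', hy'w', hw'w⟩ := h.exists_pentagon (h2.2.2 x) hxy hxw hyw
    rw [hdeg (x := x) (y := w'), ← hdeg (x := y) (y := w')]
    · rintro rfl; exact h.not_adj hw'w hxw.symm hxy.symm
    · exact h.not_adj hyy' hy'w'
    · rintro rfl; exact h.not_adj hyy' hy'w' hxy.symm
    · exact h.not_adj hxw hw'w.symm
  have hall (x y : V) : G.degree x = G.degree y := by
    by_cases hxy : x = y
    · rw [hxy]
    by_cases hn : G.Adj x y
    · obtain ⟨w, -, hwx, hwy⟩ : ∃ w ∈ Finset.univ, w ≠ x ∧ w ≠ y := by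
        by_contra! hh
        have : (Finset.univ : Finset V) ⊆ {x, y} := fun w hw ↦ by
          by_cases hwx : w = x
          · simp [hwx]
          · simp [hh w hw hwx]
        exact absurd (Finset.card_le_card this) (by have := Finset.card_le_two (a := x) (b := y); omega)
      by_cases hxw : G.Adj x w
      · exact hdeg' hn hxw hwy.symm
      by_cases hyw : G.Adj y w
      · exact (hdeg' hn.symm hyw hwx.symm).symm
      · rw [hdeg hwx.symm hxw, hdeg hwy.symm hyw]
    · exact hdeg hxy hn
  obtain ⟨a, -, b, -, c, -, hab, hac, hbc⟩ := Finset.two_lt_card.1 hcard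
  refine ⟨G.degree a, isMooreGraph_two_iff.2 ⟨hm, fun x ↦ hall x a, ?_⟩⟩
  by_contra! hh
  exact h.not_adj (hh a b hab) (hh b c hbc) (hh a c hac)

lemma isTwoConnected_and_cliqueFree_and_isCBGraph_iff [Finite V] :
    (G.IsTwoConnected ∧ G.CliqueFree 3 ∧ G.IsCBGraph) ↔ ∃ d : ℕ, G.IsMooreGraph d 2 := by
  classical
  have := Fintype.ofFinite V
  constructor
  · rintro ⟨h1, h2, h3⟩
    exact (h3.isTriangleFreeCB h2).exists_isMooreGraph h1
  · rintro ⟨d, hd⟩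
    obtain ⟨h1, h2, h3⟩ := isMooreGraph_two_iff.1 hd
    have : Nonempty V := ⟨h3.choose⟩
    exact ⟨h1.isTwoConnected h2 h3, h1.cliqueFree, h1.isCBGraph⟩

end SimpleGraph

/-! ### The possible degrees, by eigenvalue multiplicities -/

namespace SimpleGraph

lemma _root_.Matrix.trace_eq_rank_of_isIdempotentElem {n K : Type*} [Fintype n] [DecidableEq n]
    [Field K] {E : Matrix n n K} (hE : E * E = E) : E.trace = (E.rank : K) := by
  have h : IsIdempotentElem E.toLin' := by
    rw [IsIdempotentElem, Module.End.mul_eq_comp, ← Matrix.toLin'_mul, hE]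
  have h2 := ((LinearMap.isProj_range_iff_isIdempotentElem _).2 h).trace
  rw [Matrix.trace_toLin'_eq] at h2
  exact h2

variable {V : Type*} {G : SimpleGraph V} {d : ℕ} [Fintype V] [DecidableEq V] [DecidableRel G.Adj]

namespace IsGirthFiveDiamTwo

lemma isSRGWith [Nonempty V] (h : G.IsGirthFiveDiamTwo) (hd : G.IsRegularOfDegree d) :
    G.IsSRGWith (d * (d - 1) + (d + 1)) d 0 1 where
  card := h.card_eq hd
  regular := hd
  of_adj v w hvw := by
    rw [Fintype.card_eq_zero_iff]
    exact ⟨fun ⟨x, hx⟩ ↦ h.not_adj hx.1 hx.2.symm hvw⟩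
  of_not_adj v w hvw hn := by
    obtain ⟨x, hvx, hxw⟩ := h.exists_adj_adj hvw hn
    rw [Fintype.card_eq_one_iff]
    exact ⟨⟨x, hvx, hxw.symm⟩, fun ⟨y, hy⟩ ↦
      Subtype.ext (h.eq_of_adj hvw hy.1 hy.2.symm hvx hxw)⟩

lemma adjMatrix_mul_self [Nonempty V] (h : G.IsGirthFiveDiamTwo) (hd : G.IsRegularOfDegree d) :
    G.adjMatrix ℝ * G.adjMatrix ℝ =
      ((d : ℝ) - 1) • (1 : Matrix V V ℝ) - G.adjMatrix ℝ + Matrix.of fun _ _ ↦ (1 : ℝ) := by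
  have h1 := (h.isSRGWith hd).matrix_eq (α := ℝ)
  rw [pow_two] at h1
  rw [h1]
  ext v w
  simp only [Matrix.add_apply, Matrix.sub_apply, Matrix.smul_apply, adjMatrix_apply, compl_adj,
    Matrix.of_apply, Matrix.one_apply]
  by_cases hvw : v = w
  · subst hvw; simp
  · by_cases ha : G.Adj v w <;> simp [hvw, ha]

/-- The spectral projection of a Moore graph of diameter two onto the eigenspace of `r`, where
`r` and `s` are the eigenvalues other than the degree. -/
noncomputable def proj (G : SimpleGraph V) [DecidableRel G.Adj] (d : ℕ) (r s : ℝ) :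
    Matrix V V ℝ :=
  (r - s)⁻¹ • (G.adjMatrix ℝ - s • (1 : Matrix V V ℝ) -
    (((d : ℝ) - s) / ((d : ℝ) ^ 2 + 1)) • Matrix.of fun _ _ ↦ (1 : ℝ))

lemma card_real [Nonempty V] (h : G.IsGirthFiveDiamTwo) (hd : G.IsRegularOfDegree d) :
    (Fintype.card V : ℝ) = (d : ℝ) ^ 2 + 1 := by
  rw [h.card_eq hd]
  cases d with
  | zero => simp
  | succ d => rw [Nat.add_sub_cancel]; push_cast; ring

lemma proj_mul_self [Nonempty V] (h : G.IsGirthFiveDiamTwo) (hd : G.IsRegularOfDegree d) {r s : ℝ}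
    (hrs : r ≠ s) (hsum : r + s = -1) (hprod : r * s = 1 - d) :
    proj G d r s * proj G d r s = proj G d r s := by
  have hAA := h.adjMatrix_mul_self hd
  have hc := h.card_real hd
  set A := G.adjMatrix ℝ with hA
  set J : Matrix V V ℝ := Matrix.of fun _ _ ↦ (1 : ℝ) with hJ
  have hAJ : A * J = (d : ℝ) • J := by
    ext v w
    simp [hA, hJ, hd v]
  have hJA : J * A = (d : ℝ) • J := by
    ext v w
    simp [hA, hJ, hd w]
  have hJJ : J * J = ((d : ℝ) ^ 2 + 1) • J := by
    ext v w
    simp [hJ, Matrix.mul_apply, hc]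
  have hn : ((d : ℝ) ^ 2 + 1) ≠ 0 := by positivity
  have hrs' : r - s ≠ 0 := sub_ne_zero.2 hrs
  have h1 : (A - s • (1 : Matrix V V ℝ) - (((d : ℝ) - s) / ((d : ℝ) ^ 2 + 1)) • J) *
      (A - s • (1 : Matrix V V ℝ) - (((d : ℝ) - s) / ((d : ℝ) ^ 2 + 1)) • J) =
      (r - s) • (A - s • (1 : Matrix V V ℝ) - (((d : ℝ) - s) / ((d : ℝ) ^ 2 + 1)) • J) := by
    simp only [sub_mul, mul_sub, smul_mul_assoc, mul_smul_comm, one_mul, mul_one, hAA, hAJ, hJA,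
      hJJ]
    obtain rfl : r = -1 - s := by linarith
    match_scalars
    · linarith
    · linarith
    · field_simp
      nlinarith [hprod]
  rw [proj, ← hA, ← hJ, smul_mul_smul_comm, h1, smul_smul]
  congr 1
  field_simp

/-- The rank of an idempotent is its trace, and the adjacency matrix has trace zero. Integrality of
the rank restricts `d`. -/
lemma rank_proj [Nonempty V] (h : G.IsGirthFiveDiamTwo) (hd : G.IsRegularOfDegree d) {r s : ℝ}
    (hrs : r ≠ s) (hsum : r + s = -1) (hprod : r * s = 1 - d) :
    ((proj G d r s).rank : ℝ) * (r - s) = - s * (d : ℝ) ^ 2 - d := by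
  rw [← Matrix.trace_eq_rank_of_isIdempotentElem (h.proj_mul_self hd hrs hsum hprod)]
  have hn : ((d : ℝ) ^ 2 + 1) ≠ 0 := by positivity
  have hJ : (Matrix.of fun _ _ ↦ (1 : ℝ) : Matrix V V ℝ).trace = (d : ℝ) ^ 2 + 1 := by
    simp [Matrix.trace, h.card_real hd]
  rw [proj, Matrix.trace_smul, Matrix.trace_sub, Matrix.trace_sub, Matrix.trace_smul,
    Matrix.trace_smul, hJ, trace_adjMatrix, Matrix.trace_one, h.card_real hd, smul_eq_mul,
    smul_eq_mul, smul_eq_mul, div_mul_cancel₀ _ hn]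
  have hrs' : r - s ≠ 0 := sub_ne_zero.2 hrs
  field_simp
  ring

omit [Fintype V] [DecidableEq V] [DecidableRel G.Adj] in
lemma _root_.Int.moore_degree_of_mul_sq {d k : ℤ} (hd : 2 ≤ d)
    (h : k ^ 2 * (4 * d - 3) = (d ^ 2 - 2 * d) ^ 2) : d = 2 ∨ d = 3 ∨ d = 7 ∨ d = 57 := by
  by_cases hd2 : d = 2
  · exact .inl hd2
  have hpos : 0 < d ^ 2 - 2 * d := by nlinarith [show 3 ≤ d by omega]
  have hk : k ≠ 0 := by rintro rfl; nlinarith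
  obtain ⟨t, ht⟩ : k ∣ d ^ 2 - 2 * d := (Int.pow_dvd_pow_iff two_ne_zero).1 ⟨_, h.symm⟩
  have ht2 : t ^ 2 = 4 * d - 3 := by
    have hk2 : k ^ 2 ≠ 0 := pow_ne_zero 2 hk
    apply mul_left_cancel₀ hk2
    rw [h, ht]; ring
  -- Substituting `4d = t² + 3` into `16(d² - 2d) = 16kt` gives `t⁴ - 2t² - 15 = 16kt`.
  have hdvd : t ∣ 15 := ⟨t ^ 3 - 2 * t - 16 * k, by
    have h4 : 4 * d = t ^ 2 + 3 := by linarith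
    have : 16 * (d ^ 2 - 2 * d) = (4 * d) ^ 2 - 8 * (4 * d) := by ring
    rw [h4, ht] at this
    linarith⟩
  have h1 : t ≤ 15 := Int.le_of_dvd (by norm_num) hdvd
  have h2 : -t ≤ 15 := Int.le_of_dvd (by norm_num) ((neg_dvd).2 hdvd)
  have h3 : -15 ≤ t := by linarith
  interval_cases t <;> first | omega | (exfalso; revert hdvd; decide)

/-- The Hoffman–Singleton theorem on the possible degrees. -/
lemma degree_eq [Nonempty V] (h : G.IsGirthFiveDiamTwo) (hd : G.IsRegularOfDegree d)
    (h2 : 2 ≤ d) : d = 2 ∨ d = 3 ∨ d = 7 ∨ d = 57 := by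
  have h2' : (2 : ℝ) ≤ d := by exact_mod_cast h2
  have hs2 : √(4 * (d : ℝ) - 3) ^ 2 = 4 * d - 3 := Real.sq_sqrt (by linarith)
  have hs0 : 0 < √(4 * (d : ℝ) - 3) := Real.sqrt_pos.2 (by linarith)
  set σ := √(4 * (d : ℝ) - 3)
  have h1 := h.rank_proj hd (r := (-1 + σ) / 2) (s := (-1 - σ) / 2) (by intro h; linarith)
    (by ring) (by linarith)
  set m := (proj G d ((-1 + σ) / 2) ((-1 - σ) / 2)).rank
  have h3 : (2 * (m : ℝ) - (d : ℝ) ^ 2) * σ = (d : ℝ) ^ 2 - 2 * d := by linarith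
  have h4 : (2 * (m : ℝ) - (d : ℝ) ^ 2) ^ 2 * (4 * d - 3) = ((d : ℝ) ^ 2 - 2 * d) ^ 2 := by
    rw [← h3, ← hs2]; ring
  have h5 := Int.moore_degree_of_mul_sq (d := d) (k := 2 * m - d ^ 2) (by exact_mod_cast h2)
    (by exact_mod_cast h4)
  omega

/-- In a Moore graph of degree `7`, every set of at most `28` vertices is avoided by a nonzero
eigenvector for the eigenvalue `2`, up to a constant. -/
lemma exists_eigenvector [Nonempty V] (h : G.IsGirthFiveDiamTwo) (hd : G.IsRegularOfDegree 7)
    (D : Finset V) (hD : D.card ≤ 28) :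
    ∃ f : V → ℝ, f ≠ 0 ∧ (∀ v ∈ D, f v = 0) ∧
      ∀ v, ∑ w ∈ G.neighborFinset v, f w = 2 * f v + (∑ w, f w) / 10 := by
  -- The kernel of the projection onto the eigenspace of `-3` consists of constants plus
  -- eigenvectors for `2`. The rank is `21`, and `21 + 28 < 50`; the factor `1 / 10` is `(7 - 2) /
  -- (7² + 1)`.
  have h1 := h.rank_proj hd (r := -3) (s := 2) (by norm_num) (by norm_num) (by norm_num)
  have hr : (proj G 7 (-3) 2).rank = 21 := by
    have : ((proj G 7 (-3) 2).rank : ℝ) = 21 := by push_cast at h1; linarith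
    exact_mod_cast this
  have hc := h.card_eq hd
  let T : (V → ℝ) →ₗ[ℝ] LinearMap.range (proj G 7 (-3) 2).mulVecLin × (D → ℝ) :=
    (LinearMap.rangeRestrict (proj G 7 (-3) 2).mulVecLin).prod
      (LinearMap.funLeft ℝ ℝ (fun v : D ↦ (v : V)))
  have hT : LinearMap.ker T ≠ ⊥ := by
    apply LinearMap.ker_ne_bot_of_finrank_lt
    rw [Module.finrank_prod, Module.finrank_pi, Module.finrank_pi, ← Matrix.rank, hr, hc]
    simp; omega
  obtain ⟨f, hf, hf0⟩ := Submodule.exists_mem_ne_zero_of_ne_bot hT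
  rw [LinearMap.mem_ker, LinearMap.prod_apply, Function.prod_apply, Prod.mk_eq_zero] at hf
  refine ⟨f, hf0, fun v hv ↦ congrFun hf.2 ⟨v, hv⟩, fun v ↦ ?_⟩
  have h2 : (proj G 7 (-3) 2).mulVec f = 0 := by simpa using congrArg Subtype.val hf.1
  have h3 := congrFun h2 v
  rw [proj, Matrix.smul_mulVec, Matrix.sub_mulVec, Matrix.sub_mulVec, Matrix.smul_mulVec,
    Matrix.smul_mulVec, Matrix.one_mulVec] at h3
  simp only [Pi.smul_apply, Pi.sub_apply, adjMatrix_mulVec_apply, smul_eq_mul, Pi.zero_apply] at h3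
  simp only [Matrix.mulVec, dotProduct, Matrix.of_apply, one_mul] at h3
  norm_num at h3
  linarith

end IsGirthFiveDiamTwo

end SimpleGraph

/-! ### Pentagons and their outer neighbors; degree two -/

namespace SimpleGraph

/-- A bijective homomorphism onto a regular graph is an isomorphism if the degrees of its source
are large enough. -/
lemma nonempty_iso_of_injective {V W : Type*} [Fintype V] [Fintype W] {G : SimpleGraph V}
    {H : SimpleGraph W} [DecidableRel G.Adj] {d : ℕ} (hd : G.IsRegularOfDegree d)
    (hH : ∀ a, d ≤ (H.neighborSet a).ncard) (hcard : Fintype.card V = Fintype.card W) (f : W → V)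
    (hf : Function.Injective f) (hhom : ∀ a b, H.Adj a b → G.Adj (f a) (f b)) :
    Nonempty (G ≃g H) := by
  classical
  have hb : Function.Bijective f := (Fintype.bijective_iff_injective_and_card f).2 ⟨hf, hcard.symm⟩
  refine ⟨RelIso.symm ⟨Equiv.ofBijective f hb, fun {a b} ↦ ⟨fun hab ↦ ?_, hhom a b⟩⟩⟩
  have h1 : f '' H.neighborSet a = G.neighborSet (f a) := by
    refine Set.eq_of_subset_of_ncard_le ?_ ?_ (Set.toFinite _)
    · rintro _ ⟨b, hb, rfl⟩
      exact hhom a b hb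
    · rw [isRegularOfDegree_iff_ncard.1 hd, Set.ncard_image_of_injective _ hf]
      exact hH a
  obtain ⟨b', hb', hbb⟩ : f b ∈ f '' H.neighborSet a := h1 ▸ hab
  exact hf hbb ▸ hb'

variable {V : Type*} {G : SimpleGraph V} {d : ℕ}

/-- `p` lists the vertices of a closed walk of length five. -/
def IsPentagon (G : SimpleGraph V) (p : ZMod 5 → V) : Prop :=
  ∀ j, G.Adj (p j) (p (j + 1))

/-- `q` runs along a pentagram that is matched to the pentagon `p`. -/
structure IsCompanion (G : SimpleGraph V) (p q : ZMod 5 → V) : Prop where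
  adj : ∀ k, G.Adj (q k) (p k)
  ne : ∀ k l, q k ≠ p l
  step : ∀ k, G.Adj (q k) (q (k + 2))

lemma _root_.ZMod.five_cases (j k : ZMod 5) :
    k = j ∨ k = j + 1 ∨ j = k + 1 ∨ k = j + 2 ∨ j = k + 2 := by
  revert j k; decide

lemma _root_.ZMod.five_eq_zero : (5 : ZMod 5) = 0 := rfl

namespace IsGirthFiveDiamTwo

variable (h : G.IsGirthFiveDiamTwo)

include h

lemma pentagon_ne_and_not_adj {p : ZMod 5 → V} (hp : IsPentagon G p) (j : ZMod 5) :
    p j ≠ p (j + 2) ∧ ¬ G.Adj (p j) (p (j + 2)) := by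
  have h1 := hp j
  have h2 := hp (j + 1)
  have h3 := hp (j + 2)
  have h4 := hp (j + 3)
  have h5 := hp (j + 4)
  rw [show j + 4 + 1 = j by linear_combination ZMod.five_eq_zero] at h5
  rw [show j + 1 + 1 = j + 2 by ring] at h2
  rw [show j + 2 + 1 = j + 3 by ring] at h3
  rw [show j + 3 + 1 = j + 4 by ring] at h4
  refine ⟨fun he ↦ ?_, h.not_adj h1 h2⟩
  rw [← he] at h3
  exact h.not_adj h3 h4 h5.symm

lemma pentagon_adj {p : ZMod 5 → V} (hp : IsPentagon G p) {j k : ZMod 5}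
    (hjk : G.Adj (p j) (p k)) : k = j + 1 ∨ j = k + 1 := by
  rcases ZMod.five_cases j k with rfl | hk | hk | rfl | rfl
  · exact absurd rfl hjk.ne
  · exact .inl hk
  · exact .inr hk
  · exact absurd hjk (h.pentagon_ne_and_not_adj hp j).2
  · exact absurd hjk.symm (h.pentagon_ne_and_not_adj hp k).2

lemma pentagon_injective {p : ZMod 5 → V} (hp : IsPentagon G p) : Function.Injective p := by
  intro j k hjk
  rcases ZMod.five_cases j k with hk | rfl | rfl | rfl | rfl
  · exact hk.symm
  · exact absurd hjk (hp _).ne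
  · exact absurd hjk.symm (hp _).ne
  · exact absurd hjk (h.pentagon_ne_and_not_adj hp _).1
  · exact absurd hjk.symm (h.pentagon_ne_and_not_adj hp _).1

/-- A vertex outside a pentagon has at most one neighbor on it. -/
lemma eq_of_adj_pentagon {p : ZMod 5 → V} (hp : IsPentagon G p) {x : V} (hx : ∀ l, x ≠ p l)
    {j k : ZMod 5} (hj : G.Adj x (p j)) (hk : G.Adj x (p k)) : j = k := by
  have key (j : ZMod 5) (hj : G.Adj x (p j)) (hk : G.Adj x (p (j + 2))) : False := by
    have h2 := hp (j + 1)
    rw [show j + 1 + 1 = j + 2 by ring] at h2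
    exact hx _ (h.eq_of_adj (h.pentagon_ne_and_not_adj hp j).1 hj.symm hk (hp j) h2)
  rcases ZMod.five_cases j k with hk | rfl | rfl | rfl | rfl
  · exact hk.symm
  · exact absurd hk (h.not_adj hj (hp _))
  · exact absurd hj (h.not_adj hk (hp _))
  · exact (key _ hj hk).elim
  · exact (key _ hk hj).elim

lemma exists_next {p : ZMod 5 → V} (hp : IsPentagon G p) {x : V} (hx : ∀ l, x ≠ p l)
    {j : ZMod 5} (hj : G.Adj x (p j)) :
    ∃ y, G.Adj x y ∧ G.Adj y (p (j + 2)) ∧ ∀ l, y ≠ p l := by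
  obtain ⟨y, hxy, hy⟩ := h.exists_adj_adj (hx (j + 2)) fun hh ↦ by
    have := h.eq_of_adj_pentagon hp hx hj hh
    revert this; generalize j = j; revert j; decide
  refine ⟨y, hxy, hy, ?_⟩
  rintro l rfl
  obtain rfl := h.eq_of_adj_pentagon hp hx hj hxy
  exact (h.pentagon_ne_and_not_adj hp j).2 hy

/-- Adjacent outer neighbors of a pentagon are attached to vertices at distance two. -/
lemma index_of_adj {p : ZMod 5 → V} (hp : IsPentagon G p) {x y : V} (hx : ∀ l, x ≠ p l)
    (hy : ∀ l, y ≠ p l) {j k : ZMod 5} (hj : G.Adj x (p j)) (hk : G.Adj y (p k))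
    (hxy : G.Adj x y) : k = j + 2 ∨ j = k + 2 := by
  rcases ZMod.five_cases j k with rfl | rfl | rfl | hk | hk
  · exact absurd hj (h.not_adj hxy hk)
  · exact absurd (h.eq_of_adj (hx _) hxy hk hj (hp _)) (hy _)
  · exact absurd (h.eq_of_adj (hy _) hxy.symm hj hk (hp _)) (hx _)
  · exact .inl hk
  · exact .inr hk

/-- The vertex `q (k + 2)` is the only common neighbor of `q k` and `p (k + 2)`, and steps of two
exhaust `ℤ/5`. -/
lemma companion_unique {p q q' : ZMod 5 → V} (hq : IsCompanion G p q) (hq' : IsCompanion G p q')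
    {j : ZMod 5} (hj : q j = q' j) : q = q' := by
  have key (n : ℕ) : q (j + 2 * n) = q' (j + 2 * n) := by
    induction n with
    | zero => simpa using hj
    | succ n ih =>
      rw [show j + 2 * ((n + 1 : ℕ) : ZMod 5) = j + 2 * n + 2 by push_cast; ring]
      refine h.eq_of_adj (hq.ne (j + 2 * n) (j + 2 * n + 2)) (hq.step _) (hq.adj _) ?_ (hq'.adj _)
      rw [ih]
      exact hq'.step _
  ext k
  have := key (3 * (k - j)).val
  rwa [ZMod.natCast_val, ZMod.cast_id, show j + 2 * (3 * (k - j)) = k by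
    linear_combination (k - j) * ZMod.five_eq_zero] at this

omit h in
lemma IsCompanion.isPentagon {p q : ZMod 5 → V} (hq : IsCompanion G p q) :
    IsPentagon G fun k ↦ q (2 * k) := fun j ↦ by
  have := hq.step (2 * j)
  rwa [show 2 * j + 2 = 2 * (j + 1) by ring] at this

-- Doubling indices turns the pentagram into a pentagon and, as `2 * 2 = -1`, the pentagon into a
-- pentagram.
omit h in
lemma IsCompanion.symm {p q : ZMod 5 → V} (hp : IsPentagon G p) (hq : IsCompanion G p q) :
    IsCompanion G (fun k ↦ q (2 * k)) (fun k ↦ p (2 * k)) where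
  adj k := (hq.adj _).symm
  ne k l := (hq.ne _ _).symm
  step k := by
    have := (hp (2 * (k + 2))).symm
    rwa [show 2 * (k + 2) + 1 = 2 * k by linear_combination ZMod.five_eq_zero] at this

lemma eq_of_adj_companion {p q : ZMod 5 → V} (hq : IsCompanion G p q) {x : V}
    (hx : ∀ l, x ≠ q l) {j k : ZMod 5} (hj : G.Adj x (q j)) (hk : G.Adj x (q k)) : j = k := by
  have e (j : ZMod 5) : 2 * (3 * j) = j := by linear_combination j * ZMod.five_eq_zero
  have := h.eq_of_adj_pentagon (IsCompanion.isPentagon hq) (x := x) (fun l ↦ hx _) (j := 3 * j)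
    (k := 3 * k) (by rwa [e]) (by rwa [e])
  rw [← e j, ← e k, this]

section Fintype

variable [Fintype V] [DecidableRel G.Adj] (hd : G.IsRegularOfDegree d)

omit h in
/-- The neighbors of `p j` outside the pentagon `p`. -/
def outer (G : SimpleGraph V) [DecidableEq V] [DecidableRel G.Adj] (p : ZMod 5 → V) (j : ZMod 5) : Finset V :=
  {x | G.Adj x (p j) ∧ ∀ l, x ≠ p l}

omit h in
lemma exists_pentagon_of_two_le [Nonempty V] (h : G.IsGirthFiveDiamTwo)
    (hd : G.IsRegularOfDegree d) (h2 : 2 ≤ d) : ∃ p, IsPentagon G p := by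
  classical
  obtain ⟨a⟩ := ‹Nonempty V›
  have hc (a : V) : 1 < (G.neighborFinset a).card := by
    rw [card_neighborFinset_eq_degree, hd a]; omega
  obtain ⟨x, hx, y, hy, hxy⟩ := Finset.one_lt_card.1 (hc a)
  obtain ⟨x', hx', hx'a⟩ := Finset.exists_mem_ne (hc x) a
  rw [mem_neighborFinset] at hx hy hx'
  obtain ⟨z, hx'z, hzy⟩ := h.exists_adj_adj (a := x') (b := y)
    (by rintro rfl; exact h.not_adj hx hx' hy)
    (fun hh ↦ hx'a (h.eq_of_adj hxy hx' hh hx.symm hy))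
  exact ⟨![a, x, x', z, y], fun j ↦ by
    fin_cases j
    exacts [hx, hx', hx'z, hzy, hy.symm]⟩

include hd in
lemma card_outer [DecidableEq V] {p : ZMod 5 → V} (hp : IsPentagon G p) (j : ZMod 5) :
    (outer G p j).card = d - 2 := by
  have hp' := hp (j - 1)
  rw [sub_add_cancel] at hp'
  have h1 : outer G p j = ((G.neighborFinset (p j)).erase (p (j + 1))).erase (p (j - 1)) := by
    ext x
    simp only [outer, Finset.mem_filter, Finset.mem_univ, true_and, Finset.mem_erase,
      mem_neighborFinset, G.adj_comm x]
    refine ⟨fun ⟨h1, h2⟩ ↦ ⟨h2 _, h2 _, h1⟩, fun ⟨h1, h2, h3⟩ ↦ ⟨h3, ?_⟩⟩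
    rintro l rfl
    rcases h.pentagon_adj hp h3 with rfl | rfl
    · exact h2 rfl
    · exact h1 (by rw [add_sub_cancel_right])
  have hne : p (j - 1) ≠ p (j + 1) := fun hh ↦ by
    have := h.pentagon_injective hp hh
    revert this; generalize j = j; revert j; decide
  rw [h1, Finset.card_erase_of_mem (by simp [hp'.symm, hne]), Finset.card_erase_of_mem
    (by simp [hp j]), card_neighborFinset_eq_degree, hd]
  omega

include hd in
lemma nonempty_iso_cycleGraph [Nonempty V] (h2 : d = 2) :
    Nonempty (G ≃g cycleGraph 5) := by
  classical
  subst h2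
  obtain ⟨p, hp⟩ := h.exists_pentagon_of_two_le hd le_rfl
  refine nonempty_iso_of_injective (W := Fin 5) hd (fun a ↦ ?_) (by rw [h.card_eq hd]; rfl) p
    (h.pentagon_injective hp) fun a b hab ↦ ?_
  · rw [Set.ncard_eq_toFinset_card']
    revert a; decide
  · rw [cycleGraph_adj] at hab
    rcases hab with hab | hab
    · obtain rfl : a = b + 1 := by rw [← hab]; abel
      exact (hp b).symm
    · obtain rfl : b = a + 1 := by rw [← hab]; abel
      exact hp a

end Fintype

end IsGirthFiveDiamTwo

end SimpleGraph

/-! ### Degree three: the Petersen graph -/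

namespace SimpleGraph

/-- The vertices of the Petersen graph as an outer pentagon and an inner pentagram. -/
def petersenLabel : ZMod 5 ⊕ ZMod 5 → {s : Finset (Fin 5) // s.card = 2}
  | .inl j => ⟨{2 * j, 2 * j + 1}, by revert j; decide⟩
  | .inr j => ⟨{2 * j + 2, 2 * j + 4}, by revert j; decide⟩

lemma petersenLabel_bijective : Function.Bijective petersenLabel := by
  rw [Fintype.bijective_iff_injective_and_card]
  exact ⟨by decide, by decide⟩

lemma petersenGraph_adj_inl_inl (j k : ZMod 5) :
    petersenGraph.Adj (petersenLabel (.inl j)) (petersenLabel (.inl k)) → k = j + 1 ∨ j = k + 1 := by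
  change Disjoint (petersenLabel (.inl j)).1 (petersenLabel (.inl k)).1 → _
  revert j k; decide

lemma petersenGraph_adj_inl_inr (j k : ZMod 5) :
    petersenGraph.Adj (petersenLabel (.inl j)) (petersenLabel (.inr k)) → k = j := by
  change Disjoint (petersenLabel (.inl j)).1 (petersenLabel (.inr k)).1 → _
  revert j k; decide

lemma petersenGraph_adj_inr_inr (j k : ZMod 5) :
    petersenGraph.Adj (petersenLabel (.inr j)) (petersenLabel (.inr k)) → k = j + 2 ∨ j = k + 2 := by
  change Disjoint (petersenLabel (.inr j)).1 (petersenLabel (.inr k)).1 → _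
  revert j k; decide

lemma three_le_ncard_neighborSet_petersenGraph (a : {s : Finset (Fin 5) // s.card = 2}) :
    3 ≤ (petersenGraph.neighborSet a).ncard := by
  have : petersenGraph.neighborSet a =
      ((Finset.univ.filter fun b ↦ Disjoint a.1 b.1 :
        Finset {s : Finset (Fin 5) // s.card = 2}) : Set _) := by
    ext b; simp [petersenGraph]
  rw [this, Set.ncard_coe_finset]
  clear this
  revert a; decide

variable {V : Type*} {G : SimpleGraph V} {d : ℕ}

namespace IsGirthFiveDiamTwo

variable (h : G.IsGirthFiveDiamTwo) [Fintype V] [DecidableRel G.Adj]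

omit h in
lemma mem_outer [DecidableEq V] {p : ZMod 5 → V} {j : ZMod 5} {x : V} :
    x ∈ outer G p j ↔ G.Adj x (p j) ∧ ∀ l, x ≠ p l := by
  simp [outer]

include h

lemma nonempty_iso_petersenGraph [Nonempty V] (hd : G.IsRegularOfDegree 3) :
    Nonempty (G ≃g petersenGraph) := by
  classical
  obtain ⟨p, hp⟩ := h.exists_pentagon_of_two_le hd (by norm_num)
  have hx (j : ZMod 5) : ∃ x, outer G p j = {x} :=
    Finset.card_eq_one.1 (h.card_outer hd hp j)
  choose x hx using hx
  have hxj (j : ZMod 5) : G.Adj (x j) (p j) ∧ ∀ l, x j ≠ p l := by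
    rw [← mem_outer, hx]; simp
  have hstep (j : ZMod 5) : G.Adj (x j) (x (j + 2)) := by
    obtain ⟨y, hxy, hy, hyp⟩ := h.exists_next hp (hxj j).2 (hxj j).1
    have : y ∈ outer G p (j + 2) := mem_outer.2 ⟨hy, hyp⟩
    rw [hx, Finset.mem_singleton] at this
    exact this ▸ hxy
  let F : ZMod 5 ⊕ ZMod 5 → V := Sum.elim p x
  have hF : Function.Injective F := by
    refine (h.pentagon_injective hp).sumElim (fun j k hjk ↦ ?_) fun j k ↦ ((hxj k).2 j).symm
    exact h.eq_of_adj_pentagon hp (hxj j).2 (hxj j).1 (hjk ▸ (hxj k).1)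
  let e := Equiv.ofBijective _ petersenLabel_bijective
  refine nonempty_iso_of_injective hd three_le_ncard_neighborSet_petersenGraph
    (by rw [h.card_eq hd]; decide) (F ∘ e.symm) (hF.comp e.symm.injective) fun a b hab ↦ ?_
  obtain ⟨a, rfl⟩ := e.surjective a
  obtain ⟨b, rfl⟩ := e.surjective b
  simp only [Function.comp_apply, Equiv.symm_apply_apply]
  rcases a with j | j <;> rcases b with k | k
  · rcases petersenGraph_adj_inl_inl j k hab with rfl | rfl
    exacts [hp _, (hp _).symm]
  · obtain rfl := petersenGraph_adj_inl_inr j k hab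
    exact (hxj _).1.symm
  · obtain rfl := petersenGraph_adj_inl_inr k j hab.symm
    exact (hxj _).1
  · rcases petersenGraph_adj_inr_inr j k hab with rfl | rfl
    exacts [hstep _, (hstep _).symm]

/-! ### Degree seven: walks of outer neighbors close into pentagrams -/

variable {p : ZMod 5 → V} (hp : IsPentagon G p)

include hp

omit [Fintype V] [DecidableRel G.Adj] in
/-- Starting from an outer neighbor of a pentagon, one can walk along outer neighbors. -/
lemma exists_outer_walk {x : V} {j : ZMod 5} (hx : ∀ l, x ≠ p l) (hj : G.Adj x (p j)) :
    ∃ a : ℕ → V, a 0 = x ∧ (∀ n, G.Adj (a n) (p (j + 2 * n))) ∧ (∀ n l, a n ≠ p l) ∧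
      ∀ n, G.Adj (a n) (a (n + 1)) := by
  have key (y : V) (k : ZMod 5) (hy : (∀ l, y ≠ p l) ∧ G.Adj y (p k)) :
      ∃ z, G.Adj y z ∧ G.Adj z (p (k + 2)) ∧ ∀ l, z ≠ p l := h.exists_next hp hy.1 hy.2
  choose! s hs1 hs2 hs3 using key
  let a : ℕ → V := fun n ↦ Nat.rec x (fun n y ↦ s y (j + 2 * n)) n
  have ha (n : ℕ) : (∀ l, a n ≠ p l) ∧ G.Adj (a n) (p (j + 2 * n)) := by
    induction n with
    | zero => exact ⟨hx, by change G.Adj x _; simpa using hj⟩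
    | succ n ih =>
      refine ⟨hs3 _ _ ih, ?_⟩
      rw [show j + 2 * ((n + 1 : ℕ) : ZMod 5) = j + 2 * n + 2 by push_cast; ring]
      exact hs2 _ _ ih
  exact ⟨a, rfl, fun n ↦ (ha n).2, fun n ↦ (ha n).1, fun n ↦ hs1 _ _ (ha n)⟩

-- The values form an arithmetic progression, and in a finite set some vertex is visited twice, so
-- the common difference is zero.
omit [Fintype V] h hp in
lemma _root_.apply_eq_of_add_eq_two_mul [Finite V] {f : V → ℝ} {a : ℕ → V}
    (ha : ∀ n, f (a n) + f (a (n + 2)) = 2 * f (a (n + 1))) (n : ℕ) : f (a n) = f (a 0) := by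
  have h1 (n : ℕ) : f (a (n + 1)) - f (a n) = f (a 1) - f (a 0) := by
    induction n with
    | zero => simp
    | succ n ih => have := ha n; rw [← ih]; linarith
  have h2 (n : ℕ) : f (a n) = f (a 0) + n * (f (a 1) - f (a 0)) := by
    induction n with
    | zero => simp
    | succ n ih => have := h1 n; push_cast; linarith
  have h3 : f (a 1) - f (a 0) = 0 := by
    by_contra h0
    refine not_injective_infinite_finite a fun m n hmn ↦ ?_
    have := h2 m
    rw [hmn, h2 n] at this
    have h4 : ((n : ℝ) - m) * (f (a 1) - f (a 0)) = 0 := by linarith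
    have h5 := (mul_eq_zero.1 h4).resolve_right h0
    exact_mod_cast (sub_eq_zero.1 h5).symm
  rw [h2, h3]; ring

/-- An eigenvector for the eigenvalue `2` that is supported on the outer neighbors of a pentagon
is constant along walks of outer neighbors. -/
lemma eq_of_outer_walk {f : V → ℝ}
    (hf0 : ∀ v, (∀ j, G.Adj v (p j) → ∃ l, v = p l) → f v = 0)
    (hf : ∀ v, ∑ w ∈ G.neighborFinset v, f w = 2 * f v) {a : ℕ → V} {j : ZMod 5}
    (ha1 : ∀ n, G.Adj (a n) (p (j + 2 * n))) (ha2 : ∀ n l, a n ≠ p l)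
    (ha3 : ∀ n, G.Adj (a n) (a (n + 1))) (n : ℕ) : f (a n) = f (a 0) := by
  classical
  refine apply_eq_of_add_eq_two_mul (fun n ↦ ?_) n
  rw [← hf (a (n + 1))]
  have h1 := ha1 n
  have h2 := ha1 (n + 1)
  have h3 := ha1 (n + 1 + 1)
  set m := j + 2 * (n : ZMod 5) with hm
  rw [show j + 2 * ((n + 1 : ℕ) : ZMod 5) = m + 2 by rw [hm]; push_cast; ring] at h2
  rw [show j + 2 * ((n + 1 + 1 : ℕ) : ZMod 5) = m + 4 by rw [hm]; push_cast; ring] at h3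
  have hne : a n ≠ a (n + 1 + 1) := fun hh ↦ by
    rw [← hh] at h3
    have := h.eq_of_adj_pentagon hp (ha2 n) h1 h3
    revert this; generalize m = m; revert m; decide
  rw [show n + 2 = n + 1 + 1 from rfl, ← Finset.sum_pair hne]
  -- An outer neighbor of `a (n + 1)` is attached to `p m` or `p (m + 4)`, hence is one of the two
  -- walk neighbors.
  refine Finset.sum_subset ?_ fun w hw hwn ↦ hf0 w fun k hk ↦ ?_
  · intro w hw
    rw [mem_neighborFinset]
    rcases Finset.mem_insert.1 hw with rfl | hw
    · exact (ha3 n).symm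
    · rw [Finset.mem_singleton.1 hw]; exact ha3 (n + 1)
  · by_contra! hwp
    rw [mem_neighborFinset] at hw
    rw [Finset.mem_insert, Finset.mem_singleton, not_or] at hwn
    rcases h.index_of_adj hp (ha2 _) hwp h2 hk hw with rfl | hmk
    · refine hwn.2 (h.eq_of_adj (ha2 (n + 1) (m + 4)) hw ?_ (ha3 (n + 1)) h3)
      rwa [show m + 2 + 2 = m + 4 by ring] at hk
    · obtain rfl : m = k := add_right_cancel hmk
      exact hwn.1 (h.eq_of_adj (ha2 (n + 1) m) hw hk (ha3 n).symm h1)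

/-- In a Moore graph of degree `7`, the walk of outer neighbors closes after five steps. -/
lemma outer_walk_closed [Nonempty V] (hd : G.IsRegularOfDegree 7) {a : ℕ → V} {j : ZMod 5}
    (ha1 : ∀ n, G.Adj (a n) (p (j + 2 * n))) (ha2 : ∀ n l, a n ≠ p l)
    (ha3 : ∀ n, G.Adj (a n) (a (n + 1))) : a 5 = a 0 := by
  classical
  by_contra hne
  let X : Finset V := Finset.univ.biUnion fun j ↦ outer G p j
  have hX : X.card = 25 := by
    rw [Finset.card_biUnion]
    · simp [h.card_outer hd hp]
    · intro k _ l _ hkl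
      refine Finset.disjoint_left.2 fun x hxk hxl ↦ hkl ?_
      rw [mem_outer] at hxk hxl
      exact h.eq_of_adj_pentagon hp hxk.2 hxk.1 hxl.1
  have ha5 : a 5 ∈ outer G p j := by
    have := ha1 5
    rw [show j + 2 * ((5 : ℕ) : ZMod 5) = j from by
      push_cast; linear_combination 2 * ZMod.five_eq_zero] at this
    exact mem_outer.2 ⟨this, ha2 5⟩
  have ha0 : a 0 ∈ outer G p j := mem_outer.2 ⟨by simpa using ha1 0, ha2 0⟩
  -- These three vertices and the `25` vertices outside `X` use up the allowance of `28` zeros.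
  let N := ((outer G p j).erase (a 5)).erase (a 0)
  have hN : N.card = 3 := by
    rw [Finset.card_erase_of_mem (Finset.mem_erase.2 ⟨Ne.symm hne, ha0⟩),
      Finset.card_erase_of_mem ha5, h.card_outer hd hp]
  have hD : (Xᶜ ∪ N).card ≤ 28 := by
    refine (Finset.card_union_le _ _).trans ?_
    rw [Finset.card_compl, hX, hN, h.card_eq hd]
  obtain ⟨f, hf0, hfD, hf⟩ := h.exists_eigenvector hd _ hD
  have hfX (v : V) (hv : ∀ j, G.Adj v (p j) → ∃ l, v = p l) : f v = 0 := by
    refine hfD v (Finset.mem_union_left _ (Finset.mem_compl.2 fun hh ↦ ?_))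
    obtain ⟨k, -, hk⟩ := Finset.mem_biUnion.1 hh
    rw [mem_outer] at hk
    obtain ⟨l, hl⟩ := hv k hk.1
    exact hk.2 l hl
  have hfp (k : ZMod 5) : f (p k) = 0 := hfX _ fun _ _ ↦ ⟨k, rfl⟩
  -- Each sum over the neighbors of `p k` is a tenth of the total, and the five sums together give
  -- the total, so the total equals its half.
  have hS : ∑ w, f w = 0 := by
    have h1 : ∑ k, ∑ w ∈ G.neighborFinset (p k), f w = ∑ w, f w := by
      simp_rw [neighborFinset_eq_filter, Finset.sum_filter]
      rw [Finset.sum_comm]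
      refine Finset.sum_congr rfl fun w _ ↦ ?_
      by_cases hw : ∀ j, G.Adj w (p j) → ∃ l, w = p l
      · simp [hfX w hw]
      · push Not at hw
        obtain ⟨k, hk, hkl⟩ := hw
        rw [Finset.sum_eq_single k]
        · simp [hk.symm]
        · intro l _ hl
          rw [if_neg]
          exact fun hh ↦ hl (h.eq_of_adj_pentagon hp hkl hh.symm hk)
        · simp
    simp_rw [hf, hfp] at h1
    simp at h1
    linarith
  have hf' (v : V) : ∑ w ∈ G.neighborFinset v, f w = 2 * f v := by rw [hf, hS]; ring
  have hcirc := h.eq_of_outer_walk hp hfX hf' ha1 ha2 ha3 5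
  -- The eigenvalue equation at `p j`. Together with equality along the walk it makes both values
  -- zero.
  have hpair : f (a 5) + f (a 0) = 0 := by
    have h1 := hf' (p j)
    rw [hfp, mul_zero] at h1
    rw [← h1, ← Finset.sum_pair hne]
    refine Finset.sum_subset ?_ fun w hw hwn ↦ ?_
    · intro w hw
      rw [mem_neighborFinset]
      rcases Finset.mem_insert.1 hw with rfl | hw
      · exact (mem_outer.1 ha5).1.symm
      · rw [Finset.mem_singleton.1 hw]; exact (mem_outer.1 ha0).1.symm
    · by_cases hwp : ∃ l, w = p l
      · exact hfX w fun _ _ ↦ hwp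
      · push Not at hwp
        rw [Finset.mem_insert, Finset.mem_singleton, not_or] at hwn
        rw [mem_neighborFinset] at hw
        exact hfD w (Finset.mem_union_right _ (Finset.mem_erase.2 ⟨hwn.2, Finset.mem_erase.2
          ⟨hwn.1, mem_outer.2 ⟨hw.symm, hwp⟩⟩⟩))
  have hfj (y : V) (hy : y ∈ outer G p j) : f y = 0 := by
    by_cases h5 : y = a 5
    · rw [h5]; linarith
    by_cases h0 : y = a 0
    · rw [h0]; linarith
    exact hfD y (Finset.mem_union_right _ (Finset.mem_erase.2 ⟨h0, Finset.mem_erase.2 ⟨h5, hy⟩⟩))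
  refine hf0 (funext fun y ↦ ?_)
  by_cases hy : ∀ j, G.Adj y (p j) → ∃ l, y = p l
  · exact hfX y hy
  push Not at hy
  obtain ⟨k, hk, hy⟩ := hy
  obtain ⟨b, hb0, hb1, hb2, hb3⟩ := h.exists_outer_walk hp hy hk
  -- As `3` inverts `2` modulo `5`, the walk from `y` then reaches an outer neighbor of `p j`, where
  -- `f` is zero.
  rw [← hb0, ← h.eq_of_outer_walk hp hfX hf' hb1 hb2 hb3 (3 * (j - k)).val]
  refine hfj _ (mem_outer.2 ⟨?_, hb2 _⟩)
  have := hb1 (3 * (j - k)).val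
  rwa [ZMod.natCast_val, ZMod.cast_id, show k + 2 * (3 * (j - k)) = j by
    linear_combination (j - k) * ZMod.five_eq_zero] at this

/-- In a Moore graph of degree `7`, every outer neighbor of a pentagon lies on a companion. -/
lemma exists_companion [Nonempty V] (hd : G.IsRegularOfDegree 7) {x : V} {j : ZMod 5}
    (hx : ∀ l, x ≠ p l) (hj : G.Adj x (p j)) : ∃ q, IsCompanion G p q ∧ q j = x := by
  obtain ⟨a, ha0, ha1, ha2, ha3⟩ := h.exists_outer_walk hp hx hj
  have ha5 := h.outer_walk_closed hp hd ha1 ha2 ha3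
  have hstep (m : ZMod 5) : G.Adj (a m.val) (a (m + 1).val) := by
    fin_cases m
    exacts [ha3 0, ha3 1, ha3 2, ha3 3, ha5 ▸ ha3 4]
  refine ⟨fun k ↦ a (3 * (k - j)).val, ⟨fun k ↦ ?_, fun k ↦ ha2 _, fun k ↦ ?_⟩, by simpa using ha0⟩
  · have := ha1 (3 * (k - j)).val
    rwa [ZMod.natCast_val, ZMod.cast_id, show j + 2 * (3 * (k - j)) = k by
      linear_combination (k - j) * ZMod.five_eq_zero] at this
  · have := hstep (3 * (k - j))
    rwa [show 3 * (k - j) + 1 = 3 * (k + 2 - j) by linear_combination - ZMod.five_eq_zero] at this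

end IsGirthFiveDiamTwo

end SimpleGraph

/-! ### Degree seven: uniqueness of the Hoffman–Singleton graph -/

namespace SimpleGraph

section LatinSquare

set_option maxRecDepth 100000 in
lemma _root_.ZMod.five_orthomorphism : ∀ a b c e : ZMod 5,
    [0, a, b, c, e].Nodup → [0, a - 1, b - 2, c - 3, e - 4].Nodup →
      b = a * 2 ∧ c = a * 3 ∧ e = a * 4 := by
  decide

lemma _root_.ZMod.five_eq_mul {g : ZMod 5 → ZMod 5} (h0 : g 0 = 0) (h1 : Function.Injective g)
    (h2 : Function.Injective fun t ↦ g t - t) (t : ZMod 5) : g t = g 1 * t := by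
  have e1 : [0, g 1, g 2, g 3, g 4].Nodup := by
    have := (show ([0, 1, 2, 3, 4] : List (ZMod 5)).Nodup by decide).map h1
    simpa only [List.map_cons, List.map_nil, h0] using this
  have e2 : [0, g 1 - 1, g 2 - 2, g 3 - 3, g 4 - 4].Nodup := by
    have := (show ([0, 1, 2, 3, 4] : List (ZMod 5)).Nodup by decide).map h2
    simpa only [List.map_cons, List.map_nil, h0, sub_zero] using this
  obtain ⟨h3, h4, h5⟩ := ZMod.five_orthomorphism _ _ _ _ e1 e2
  fin_cases t
  · exact h0.trans (mul_zero _).symm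
  · exact (mul_one _).symm
  · exact h3
  · exact h4
  · exact h5

/-- A generalized Hadamard matrix of order five over `ℤ/5` is a multiplication table. -/
lemma exists_equiv_mul {ι κ : Type*} [Fintype ι] [Fintype κ] (hι : Fintype.card ι = 5)
    (hκ : Fintype.card κ = 5) (c : ι → κ → ZMod 5) (h₀ : ι) (i₀ : κ) (hr : ∀ i, c h₀ i = 0)
    (hc : ∀ h, c h i₀ = 0)
    (hinj : ∀ h h' i i', h ≠ h' → c h i - c h' i = c h i' - c h' i' → i = i') :
    ∃ (β : ι ≃ ZMod 5) (α : κ ≃ ZMod 5), ∀ h i, c h i = β h * α i := by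
  have : Nontrivial ι := Fintype.one_lt_card_iff_nontrivial.1 (by omega)
  obtain ⟨h₁, hh₁⟩ := exists_ne h₀
  have hα : Function.Bijective (c h₁) := by
    rw [Fintype.bijective_iff_injective_and_card]
    exact ⟨fun i i' hi ↦ hinj h₁ h₀ i i' hh₁ (by simpa [hr] using hi), by rw [hκ, ZMod.card]⟩
  let α := Equiv.ofBijective _ hα
  have hαi (i : κ) : α i = c h₁ i := rfl
  have hi₀ : α.symm 0 = i₀ := by rw [Equiv.symm_apply_eq, hαi, hc]
  let i₁ := α.symm 1
  have hi₁ : i₁ ≠ i₀ := by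
    intro hh
    rw [← hi₀] at hh
    exact absurd (α.symm.injective hh) (by decide)
  have hβ : Function.Bijective fun h ↦ c h i₁ := by
    rw [Fintype.bijective_iff_injective_and_card]
    refine ⟨fun h h' (hh : c h i₁ = c h' i₁) ↦ ?_, by rw [hι, ZMod.card]⟩
    by_contra hne
    exact hi₁ (hinj h h' i₁ i₀ hne (by rw [hh, hc, hc]; simp))
  let β := Equiv.ofBijective _ hβ
  refine ⟨β, α, fun h i ↦ ?_⟩
  have hβh : β h = c h i₁ := rfl
  by_cases e0 : h = h₀
  · subst e0
    rw [hβh, hr, hr, zero_mul]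
  by_cases e1 : h = h₁
  · subst e1
    rw [hβh, ← hαi, ← hαi, Equiv.apply_symm_apply, one_mul]
  have hαs (t : ZMod 5) : c h₁ (α.symm t) = t := α.apply_symm_apply t
  -- In the coordinate `α`, row `h₁` is the identity. Comparing row `h` with the zero row and with
  -- row `h₁` makes `g` and `g - id` injective.
  have key := ZMod.five_eq_mul (g := fun t ↦ c h (α.symm t)) (by rw [hi₀, hc])
    (fun t t' ht ↦ α.symm.injective (hinj h h₀ _ _ e0 (by simpa [hr] using ht)))
    (fun t t' ht ↦ α.symm.injective (hinj h h₁ _ _ e1 (by simpa only [hαs] using ht))) (α i)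
  rw [hβh]
  simpa using key

end LatinSquare

variable {V : Type*} {G : SimpleGraph V}

lemma seven_le_ncard_neighborSet_hoffmanSingletonGraph
    (a : (ZMod 5 × ZMod 5) ⊕ (ZMod 5 × ZMod 5)) :
    7 ≤ (hoffmanSingletonGraph.neighborSet a).ncard := by
  rcases a with ⟨h, j⟩ | ⟨i, k⟩
  · let f : ZMod 5 ⊕ Fin 2 → (ZMod 5 × ZMod 5) ⊕ (ZMod 5 × ZMod 5) :=
      Sum.elim (fun i ↦ .inr (i, h * i + j)) (fun s ↦ .inl (h, ![j + 1, j - 1] s))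
    have hf : Function.Injective f := by
      refine Function.Injective.sumElim (fun i i' hi ↦ ?_) (fun s s' hs ↦ ?_) fun _ _ ↦ by simp
      · simpa using (Prod.ext_iff.1 (Sum.inr_injective hi)).1
      · have h1 : ![j + 1, j - 1] s = ![j + 1, j - 1] s' :=
          (Prod.ext_iff.1 (Sum.inl_injective hs)).2
        revert h1; clear * -; revert j s s'; decide
    have h1 : Set.range f ⊆ hoffmanSingletonGraph.neighborSet (.inl (h, j)) := by
      rintro _ ⟨i | s, rfl⟩
      · exact (rfl : h * i + j = h * i + j)
      · refine (⟨rfl, ?_⟩ : h = h ∧ _)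
        fin_cases s <;> simp
    have h2 := Set.ncard_le_ncard h1 (Set.toFinite _)
    rwa [← Set.image_univ, Set.ncard_image_of_injective _ hf, Set.ncard_univ,
      Nat.card_eq_fintype_card, Fintype.card_sum, ZMod.card, Fintype.card_fin] at h2
  · let f : ZMod 5 ⊕ Fin 2 → (ZMod 5 × ZMod 5) ⊕ (ZMod 5 × ZMod 5) :=
      Sum.elim (fun h ↦ .inl (h, k - h * i)) (fun s ↦ .inr (i, ![k + 2, k - 2] s))
    have hf : Function.Injective f := by
      refine Function.Injective.sumElim (fun i i' hi ↦ ?_) (fun s s' hs ↦ ?_) fun _ _ ↦ by simp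
      · simpa using (Prod.ext_iff.1 (Sum.inl_injective hi)).1
      · have h1 : ![k + 2, k - 2] s = ![k + 2, k - 2] s' :=
          (Prod.ext_iff.1 (Sum.inr_injective hs)).2
        revert h1; clear * -; revert k s s'; decide
    have h1 : Set.range f ⊆ hoffmanSingletonGraph.neighborSet (.inr (i, k)) := by
      rintro _ ⟨h | s, rfl⟩
      · change k = h * i + (k - h * i)
        ring
      · refine (⟨rfl, ?_⟩ : i = i ∧ _)
        fin_cases s <;> simp
    have h2 := Set.ncard_le_ncard h1 (Set.toFinite _)
    rwa [← Set.image_univ, Set.ncard_image_of_injective _ hf, Set.ncard_univ,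
      Nat.card_eq_fintype_card, Fintype.card_sum, ZMod.card, Fintype.card_fin] at h2

/-- The pentagons `P h` and pentagrams `Q i` of a Hoffman–Singleton graph, the edges between
them being given by the rule `P h j ∼ Q i (j + c h i)`. -/
lemma nonempty_iso_hoffmanSingletonGraph_of_labelling [Fintype V] [DecidableRel G.Adj]
    (hd : G.IsRegularOfDegree 7) (hcard : Fintype.card V = 50) {ι κ : Type*}
    {P : ι → ZMod 5 → V} {Q : κ → ZMod 5 → V} {c : ι → κ → ZMod 5}
    (hP : ∀ h j, G.Adj (P h j) (P h (j + 1))) (hQ : ∀ i k, G.Adj (Q i k) (Q i (k + 2)))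
    (hPQ : ∀ h i j, G.Adj (P h j) (Q i (j + c h i)))
    (hPinj : ∀ h h' j j', P h j = P h' j' → h = h' ∧ j = j')
    (hQinj : ∀ i i' k k', Q i k = Q i' k' → i = i' ∧ k = k') (hne : ∀ h i j k, P h j ≠ Q i k)
    (β : ι ≃ ZMod 5) (α : κ ≃ ZMod 5) (hc : ∀ h i, c h i = β h * α i) :
    Nonempty (G ≃g hoffmanSingletonGraph) := by
  let f : (ZMod 5 × ZMod 5) ⊕ (ZMod 5 × ZMod 5) → V :=
    Sum.elim (fun x ↦ P (β.symm x.1) x.2) (fun x ↦ Q (α.symm x.1) x.2)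
  have hf : Function.Injective f := by
    refine Function.Injective.sumElim ?_ ?_ fun x y ↦ hne _ _ _ _
    · rintro ⟨h, j⟩ ⟨h', j'⟩ hh
      obtain ⟨h1, h2⟩ := hPinj _ _ _ _ hh
      exact Prod.ext (β.symm.injective h1) h2
    · rintro ⟨h, j⟩ ⟨h', j'⟩ hh
      obtain ⟨h1, h2⟩ := hQinj _ _ _ _ hh
      exact Prod.ext (α.symm.injective h1) h2
  have hPQ' (h i j : ZMod 5) : G.Adj (P (β.symm h) j) (Q (α.symm i) (h * i + j)) := by
    have := hPQ (β.symm h) (α.symm i) j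
    rwa [hc, Equiv.apply_symm_apply, Equiv.apply_symm_apply, add_comm] at this
  refine nonempty_iso_of_injective hd seven_le_ncard_neighborSet_hoffmanSingletonGraph
    (by rw [hcard]; simp [ZMod.card]) f hf ?_
  rintro (⟨h, j⟩ | ⟨i, k⟩) (⟨h', j'⟩ | ⟨i', k'⟩) hab
  · obtain ⟨rfl, rfl | rfl⟩ : h = h' ∧ (j' = j + 1 ∨ j = j' + 1) := hab
    exacts [hP _ _, (hP _ _).symm]
  · obtain rfl : k' = h * i' + j := hab
    exact hPQ' _ _ _
  · obtain rfl : k = h' * i + j' := hab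
    exact (hPQ' _ _ _).symm
  · obtain ⟨rfl, rfl | rfl⟩ : i = i' ∧ (k' = k + 2 ∨ k = k' + 2) := hab
    exacts [hQ _ _, (hQ _ _).symm]

/-- Consecutive values differ by `1` or `-1`, and a change of sign would repeat a value. -/
lemma _root_.ZMod.five_eq_add_or_eq_sub {f : ZMod 5 → ZMod 5} (hf : Function.Injective f)
    (h2 : ∀ j, f (j + 1) ≠ f j + 2 ∧ f j ≠ f (j + 1) + 2) :
    (∀ j, f j = f 0 + j) ∨ ∀ j, f j = f 0 - j := by
  have h1 (j : ZMod 5) : f (j + 1) = f j + 1 ∨ f (j + 1) = f j - 1 := by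
    rcases ZMod.five_cases (f j) (f (j + 1)) with h0 | h0 | h0 | h0 | h0
    · exact absurd (hf h0) (by clear * -; revert j; decide)
    · exact .inl h0
    · exact .inr (eq_sub_of_add_eq h0.symm)
    · exact absurd h0 (h2 j).1
    · exact absurd h0 (h2 j).2
  have hne (j : ZMod 5) : f (j + 1 + 1) ≠ f j := fun hh ↦ by
    have := hf hh
    revert this; generalize j = j; revert j; decide
  have key (n : ℕ) : (f (0 + 1) = f 0 + 1 → f (n + 1) = f n + 1 ∧ f n = f 0 + n) ∧
      (f (0 + 1) = f 0 - 1 → f (n + 1) = f n - 1 ∧ f n = f 0 - n) := by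
    induction n with
    | zero => simp
    | succ n ih =>
      push_cast
      refine ⟨fun h0 ↦ ?_, fun h0 ↦ ?_⟩
      · obtain ⟨i1, i2⟩ := ih.1 h0
        refine ⟨(h1 _).resolve_right fun hh ↦ hne n ?_, by rw [i1, i2]; ring⟩
        rw [hh, i1]; ring
      · obtain ⟨i1, i2⟩ := ih.2 h0
        refine ⟨(h1 _).resolve_left fun hh ↦ hne n ?_, by rw [i1, i2]; ring⟩
        rw [hh, i1]; ring
  refine (h1 0).imp (fun h0 j ↦ ?_) (fun h0 j ↦ ?_)
  · have := ((key j.val).1 h0).2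
    rwa [ZMod.natCast_val, ZMod.cast_id] at this
  · have := ((key j.val).2 h0).2
    rwa [ZMod.natCast_val, ZMod.cast_id] at this

namespace IsGirthFiveDiamTwo

variable (h : G.IsGirthFiveDiamTwo) [Fintype V] [DecidableEq V] [DecidableRel G.Adj]

include h

lemma exists_companion_family [Nonempty V] (hd : G.IsRegularOfDegree 7) {p : ZMod 5 → V}
    (hp : IsPentagon G p) : ∃ Q : outer G p 0 → ZMod 5 → V, (∀ i, IsCompanion G p (Q i)) ∧
      (∀ k y, G.Adj y (p k) → (∀ l, y ≠ p l) → ∃ i, y = Q i k) ∧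
      ∀ i i' k k', Q i k = Q i' k' → i = i' ∧ k = k' := by
  have key (i : outer G p 0) : ∃ q, IsCompanion G p q ∧ q 0 = i :=
    h.exists_companion hp hd (mem_outer.1 i.2).2 (mem_outer.1 i.2).1
  choose Q hQ hQ0 using key
  refine ⟨Q, hQ, fun k y hy hyp ↦ ?_, fun i i' k k' hk ↦ ?_⟩
  · obtain ⟨q, hq, hqk⟩ := h.exists_companion hp hd hyp hy
    refine ⟨⟨q 0, mem_outer.2 ⟨hq.adj 0, hq.ne 0⟩⟩, ?_⟩
    exact hqk.symm.trans (congrFun (h.companion_unique hq (hQ _) (j := 0) (by rw [hQ0])) k)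
  · obtain rfl := h.eq_of_adj_pentagon hp ((hQ i).ne k) ((hQ i).adj k) (hk ▸ (hQ i').adj k')
    refine ⟨Subtype.ext ?_, rfl⟩
    rw [← hQ0, ← hQ0, h.companion_unique (hQ i) (hQ i') hk]

lemma nonempty_iso_hoffmanSingletonGraph [Nonempty V] (hd : G.IsRegularOfDegree 7) :
    Nonempty (G ≃g hoffmanSingletonGraph) := by
  obtain ⟨p, hp⟩ := h.exists_pentagon_of_two_le hd (by norm_num)
  obtain ⟨Q, hQ, hQex, hQinj⟩ := h.exists_companion_family hd hp
  have hκ : Fintype.card (outer G p 0) = 5 := by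
    rw [Fintype.card_coe, h.card_outer hd hp]
  obtain ⟨i₀⟩ : Nonempty (outer G p 0) := Fintype.card_pos_iff.1 (by omega)
  have hp' := IsCompanion.isPentagon (hQ i₀)
  obtain ⟨P', hP', hP'ex, hP'inj⟩ := h.exists_companion_family hd hp'
  have hι : Fintype.card (outer G (fun k ↦ Q i₀ (2 * k)) 0) = 5 := by
    rw [Fintype.card_coe, h.card_outer hd hp']
  have e6 (k : ZMod 5) : 2 * (3 * k) = k := by linear_combination k * ZMod.five_eq_zero
  let P := fun h k ↦ P' h (3 * k)
  have hPQ₀ (h k) : G.Adj (P h k) (Q i₀ k) := by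
    have := (hP' h).adj (3 * k)
    rwa [e6] at this
  have hPne (h k l) : P h k ≠ Q i₀ l := by
    have := (hP' h).ne (3 * k) (3 * l)
    rwa [e6] at this
  have hPstep (h j) : G.Adj (P h j) (P h (j + 1)) := by
    have := ((hP' h).step (3 * (j + 1))).symm
    rwa [show 3 * (j + 1) + 2 = 3 * j by linear_combination ZMod.five_eq_zero] at this
  have hPinj (h h' j j') (hh : P h j = P h' j') : h = h' ∧ j = j' := by
    obtain ⟨h1, h2⟩ := hP'inj _ _ _ _ hh
    exact ⟨h1, by rw [← e6 j, ← e6 j', h2]⟩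
  -- The pentagon `p` is itself a companion of `Q i₀`, so it occurs as some `P h₀`, which normalizes
  -- one row of shifts to zero.
  have hpent := IsCompanion.symm hp (hQ i₀)
  obtain ⟨h₀, hh₀⟩ := hP'ex 0 (p (2 * 0)) (hpent.adj 0) (hpent.ne 0)
  have hPh₀ (k) : P h₀ k = p k := by
    have := congrFun (h.companion_unique hpent (hP' h₀) hh₀) (3 * k)
    rw [e6] at this
    exact this.symm
  -- the two halves are disjoint
  have hne (h' i j k) : P h' j ≠ Q i k := by
    intro hh
    have hi : i ≠ i₀ := by rintro rfl; exact hPne _ _ _ hh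
    have hadj := hPQ₀ h' j
    rw [hh] at hadj
    rcases h.index_of_adj hp ((hQ i).ne k) ((hQ i₀).ne j) ((hQ i).adj k) ((hQ i₀).adj j) hadj
      with rfl | rfl
    · exact hi (hQinj _ _ _ _ (h.eq_of_adj ((hQ i).ne k _) ((hQ i).step k) ((hQ i).adj _) hadj
        ((hQ i₀).adj _))).1
    · exact hi (hQinj _ _ _ _ (h.eq_of_adj ((hQ i₀).ne j _) hadj.symm ((hQ i).adj _)
        ((hQ i₀).step j) ((hQ i₀).adj _))).1
  -- every vertex of `P` has a neighbor in every pentagram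
  have hex (h' i j) : ∃ k, G.Adj (P h' j) (Q i k) := by
    by_cases hh : h' = h₀
    · exact ⟨j, by rw [hh, hPh₀]; exact ((hQ i).adj j).symm⟩
    have hnp (l) : P h' j ≠ p l := fun hl ↦ hh (hPinj h' h₀ j l (by rw [hl, hPh₀])).1
    -- Off `p`, the vertex `P h' j` has a common neighbor with each `p k`. These five neighbors lie
    -- on different pentagrams, hence on all five.
    have key (k) : ∃ i, G.Adj (P h' j) (Q i k) := by
      obtain ⟨z, hz, hzk⟩ := h.exists_adj_adj (hnp k) fun hadj ↦ by
        obtain ⟨i, hi⟩ := hQex k _ hadj hnp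
        exact hne _ _ _ _ hi
      obtain ⟨i, rfl⟩ := hQex k z hzk fun l hl ↦ by
        obtain ⟨i, hi⟩ := hQex l (P h' j) (hl ▸ hz) hnp
        exact hne _ _ _ _ hi
      exact ⟨i, hz⟩
    choose g hg using key
    have hgb : Function.Bijective g := by
      rw [Fintype.bijective_iff_injective_and_card]
      refine ⟨fun k k' hk ↦ ?_, by rw [hκ, ZMod.card]⟩
      exact h.eq_of_adj_companion (hQ (g k)) (hne _ _ _) (hg k) (hk ▸ hg k')
    obtain ⟨k, rfl⟩ := hgb.2 i
    exact ⟨k, hg k⟩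
  choose m hm using hex
  have hmu {h' i j k} (hk : G.Adj (P h' j) (Q i k)) : m h' i j = k :=
    h.eq_of_adj_companion (hQ i) (hne _ _ _) (hm _ _ _) hk
  have hm₀ (i j) : m h₀ i j = j := hmu (by rw [hPh₀]; exact ((hQ i).adj j).symm)
  have hmi₀ (h' j) : m h' i₀ j = j := hmu (hPQ₀ h' j)
  -- there are no quadrangles
  have hsq {h₁ h₂ i₁ i₂ j₁ j₂} (hh : h₁ ≠ h₂) (e1 : m h₁ i₁ j₁ = m h₂ i₁ j₂)
      (e2 : m h₁ i₂ j₁ = m h₂ i₂ j₂) : i₁ = i₂ :=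
    (hQinj _ _ _ _ (h.eq_of_adj (fun hP ↦ hh (hPinj _ _ _ _ hP).1) (hm h₁ i₁ j₁)
      (e1 ▸ (hm h₂ i₁ j₂).symm) (hm h₁ i₂ j₁) (e2 ▸ (hm h₂ i₂ j₂).symm))).1
  have hminj (h' i) : Function.Injective (m h' i) := fun j j' hj ↦
    h.eq_of_adj_pentagon (p := P h') (hPstep h') (fun l ↦ (hne h' i l _).symm) (hm h' i j).symm
      (hj ▸ (hm h' i j').symm)
  have hmstep (h' i j) : m h' i (j + 1) ≠ m h' i j + 2 ∧ m h' i j ≠ m h' i (j + 1) + 2 := by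
    refine ⟨fun hh ↦ ?_, fun hh ↦ ?_⟩
    · refine hne h' i (j + 1) (m h' i j) (h.eq_of_adj (hne h' i j (m h' i (j + 1)))
        (hPstep h' j) (hm _ _ _) (hm _ _ _) ?_)
      rw [hh]; exact (hQ i).step _
    · refine hne h' i j (m h' i (j + 1)) (h.eq_of_adj (hne h' i (j + 1) (m h' i j))
        (hPstep h' j).symm (hm _ _ _) (hm _ _ _) ?_)
      rw [hh]; exact (hQ i).step _
  have hmc (h' i j) : m h' i j = j + m h' i 0 := by
    by_cases hh : h' = h₀
    · rw [hh, hm₀, hm₀, add_zero]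
    by_cases hi : i = i₀
    · rw [hi, hmi₀, hmi₀, add_zero]
    rcases ZMod.five_eq_add_or_eq_sub (hminj h' i) (hmstep h' i) with h1 | h1
    · rw [h1, add_comm]
    -- A reflection `j ↦ c - j` fixes `3c`. At this index `P h'` and `P h₀` would have common
    -- neighbors on both `Q i` and `Q i₀`.
    · refine absurd (hsq (j₁ := 3 * m h' i 0) (j₂ := 3 * m h' i 0) hh ?_ ?_) hi
      · rw [hm₀, h1]
        linear_combination -m h' i 0 * ZMod.five_eq_zero
      · rw [hm₀, hmi₀]
  obtain ⟨β, α, hc⟩ := exists_equiv_mul hι hκ (fun h' i ↦ m h' i 0) h₀ i₀ (fun i ↦ hm₀ i 0)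
    (fun h' ↦ hmi₀ h' 0) fun h₁ h₂ i₁ i₂ hh he ↦ by
      refine hsq (j₁ := 0) (j₂ := m h₁ i₁ 0 - m h₂ i₁ 0) hh ?_ ?_
      · rw [hmc h₂ i₁ (_ - _)]; ring
      · rw [hmc h₂ i₂ (_ - _), he]; ring
  exact nonempty_iso_hoffmanSingletonGraph_of_labelling hd (by rw [h.card_eq hd]) hPstep
    (fun i ↦ (hQ i).step) (fun h' i j ↦ by rw [← hmc]; exact hm _ _ _) hPinj hQinj hne β α hc

end IsGirthFiveDiamTwo

/-- Moore graphs of diameter two have degree `2`, `3`, `7` or `57`, and the first three are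
unique. -/
lemma IsMooreGraph.nonempty_iso_or [Finite V] {d : ℕ} (hG : G.IsMooreGraph d 2) :
    Nonempty (G ≃g cycleGraph 5) ∨ Nonempty (G ≃g petersenGraph) ∨
      Nonempty (G ≃g hoffmanSingletonGraph) ∨ G.IsMooreGraph 57 2 := by
  classical
  have := Fintype.ofFinite V
  obtain ⟨h, hd, hne⟩ := isMooreGraph_two_iff.1 hG
  have : Nonempty V := ⟨hne.choose⟩
  rcases h.degree_eq hd (h.two_le_degree hd hne) with rfl | rfl | rfl | rfl
  · exact .inl (h.nonempty_iso_cycleGraph hd rfl)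
  · exact .inr (.inl (h.nonempty_iso_petersenGraph hd))
  · exact .inr (.inr (.inl (h.nonempty_iso_hoffmanSingletonGraph hd)))
  · exact .inr (.inr (.inr hG))

end SimpleGraph

/-! ### Blocks are isometric and inherit convexity of balls -/

namespace SimpleGraph

variable {V : Type*} {G : SimpleGraph V}

/-- This replaces walks in nested subtypes by chains of a relation on `V`; `h2` says that chains
starting in the image of `f` stay there. -/
lemma preconnected_iff_reflTransGen {W : Type*} {T : SimpleGraph W} {f : W → V}
    (hf : Function.Injective f) {R : V → V → Prop} (h1 : ∀ u w, T.Adj u w ↔ R (f u) (f w))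
    (h2 : ∀ u y, R (f u) y → ∃ w, f w = y) :
    T.Preconnected ↔ ∀ u w, Relation.ReflTransGen R (f u) (f w) := by
  refine forall₂_congr fun u w ↦ ⟨fun h ↦ ?_, fun h ↦ ?_⟩
  · rw [reachable_iff_reflTransGen] at h
    exact h.lift f fun a b hab ↦ (h1 a b).1 hab
  · have key (y : V) (hy : Relation.ReflTransGen R (f u) y) : ∃ w, f w = y ∧ T.Reachable u w := by
      induction hy with
      | refl => exact ⟨u, rfl, Reachable.refl u⟩
      | tail _ hbc ih =>
        obtain ⟨w, rfl, hw⟩ := ih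
        obtain ⟨w', rfl⟩ := h2 w _ hbc
        exact ⟨w', rfl, hw.trans ((h1 w w').2 hbc).reachable⟩
    obtain ⟨w', hw', hu⟩ := key _ h
    exact hf hw' ▸ hu

/-- Adjacency in the subgraph `K` after deleting the vertex `z`. -/
def AdjAvoiding (K : G.Subgraph) (z x y : V) : Prop :=
  K.Adj x y ∧ x ≠ z ∧ y ≠ z

lemma isNonseparable_coe_iff {K : G.Subgraph} : K.coe.IsNonseparable ↔ K.verts.Nonempty ∧
    (∀ x ∈ K.verts, ∀ y ∈ K.verts, Relation.ReflTransGen K.Adj x y) ∧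
    ∀ z ∈ K.verts, ∀ x ∈ K.verts, ∀ y ∈ K.verts, x ≠ z → y ≠ z →
      Relation.ReflTransGen (AdjAvoiding K z) x y := by
  rw [IsNonseparable, connected_iff, preconnected_iff_reflTransGen (f := Subtype.val) (R := K.Adj)
    Subtype.val_injective (fun _ _ ↦ Iff.rfl) (fun u y h ↦ ⟨⟨y, h.snd_mem⟩, rfl⟩),
    Set.nonempty_coe_sort]
  have h3 (z : K.verts) : (K.coe.induce {w | w ≠ z}).Preconnected ↔
      ∀ x ∈ K.verts, ∀ y ∈ K.verts, x ≠ z → y ≠ z →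
        Relation.ReflTransGen (AdjAvoiding K z) x y := by
    rw [preconnected_iff_reflTransGen (f := fun x ↦ (x.1.1 : V)) (R := AdjAvoiding K z)
      (Subtype.val_injective.comp Subtype.val_injective)]
    · constructor
      · intro h x hx y hy hxz hyz
        exact h ⟨⟨x, hx⟩, fun hh ↦ hxz (congrArg Subtype.val hh)⟩
          ⟨⟨y, hy⟩, fun hh ↦ hyz (congrArg Subtype.val hh)⟩
      · intro h x y
        exact h _ x.1.2 _ y.1.2 (fun hh ↦ x.2 (Subtype.ext hh)) (fun hh ↦ y.2 (Subtype.ext hh))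
    · intro u w
      exact ⟨fun h ↦ ⟨h, fun hh ↦ u.2 (Subtype.ext hh), fun hh ↦ w.2 (Subtype.ext hh)⟩,
        fun h ↦ h.1⟩
    · intro u y h
      exact ⟨⟨⟨y, h.1.snd_mem⟩, fun hh ↦ h.2.2 (congrArg Subtype.val hh)⟩, rfl⟩
  simp_rw [h3, SetCoe.forall]
  tauto

lemma Walk.reflTransGen_adjAvoiding {K : G.Subgraph} {u v z : V} (q : G.Walk u v)
    (hq : q.toSubgraph ≤ K) (hz : z ∉ q.support) :
    Relation.ReflTransGen (AdjAvoiding K z) u v := by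
  induction q with
  | nil => exact .refl
  | @cons u w v huw q ih =>
    rw [Walk.toSubgraph, sup_le_iff] at hq
    rw [Walk.support_cons, List.mem_cons, not_or] at hz
    refine .head ⟨hq.1.2 (by simp), Ne.symm hz.1, ?_⟩ (ih hq.2 hz.2)
    rintro rfl
    exact hz.2 q.start_mem_support

lemma Walk.reflTransGen_adj {K : G.Subgraph} {u v : V} (q : G.Walk u v)
    (hq : q.toSubgraph ≤ K) : Relation.ReflTransGen K.Adj u v := by
  induction q with
  | nil => exact .refl
  | @cons u w v huw q ih =>
    rw [Walk.toSubgraph, sup_le_iff] at hq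
    exact .head (hq.1.2 (by simp)) (ih hq.2)

lemma reflTransGen_adjAvoiding_symm {K : G.Subgraph} {z x y : V}
    (h : Relation.ReflTransGen (AdjAvoiding K z) x y) :
    Relation.ReflTransGen (AdjAvoiding K z) y x :=
  have : Std.Symm (AdjAvoiding K z) := ⟨fun _ _ h ↦ ⟨h.1.symm, h.2.2, h.2.1⟩⟩
  Std.Symm.symm _ _ h

/-- Adding a path with ends in a nonseparable subgraph keeps it nonseparable. -/
lemma isNonseparable_sup_toSubgraph {H : G.Subgraph} (hH : H.coe.IsNonseparable) {a b : V}
    (ha : a ∈ H.verts) (hb : b ∈ H.verts) {p : G.Walk a b} (hp : p.IsPath) :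
    (H ⊔ p.toSubgraph).coe.IsNonseparable := by
  classical
  obtain ⟨hne, hc, hn⟩ := isNonseparable_coe_iff.1 hH
  set K := H ⊔ p.toSubgraph with hK
  have hHK : H ≤ K := le_sup_left
  have hpK : p.toSubgraph ≤ K := le_sup_right
  have hverts (y : V) (hy : y ∈ K.verts) : y ∈ H.verts ∨ y ∈ p.support := by
    rwa [hK, Subgraph.verts_sup, Set.mem_union, Walk.mem_verts_toSubgraph] at hy
  have hsplit (y : V) (hy : y ∈ p.support) : (p.takeUntil y hy).toSubgraph ≤ K ∧
      (p.dropUntil y hy).toSubgraph ≤ K := by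
    rw [← p.take_spec hy, Walk.toSubgraph_append, sup_le_iff] at hpK
    exact hpK
  rw [isNonseparable_coe_iff]
  refine ⟨⟨a, hHK.1 ha⟩, ?_, ?_⟩
  · have key (y : V) (hy : y ∈ K.verts) : Relation.ReflTransGen K.Adj a y := by
      rcases hverts y hy with hy | hy
      · exact (hc a ha y hy).lift id fun _ _ h ↦ hHK.2 h
      · exact Walk.reflTransGen_adj _ (hsplit y hy).1
    have : Std.Symm K.Adj := ⟨fun _ _ h ↦ h.symm⟩
    exact fun x hx y hy ↦ (Std.Symm.symm _ _ (key x hx)).trans (key y hy)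
  · intro z hz
    have hHz (x : V) (hx : x ∈ H.verts) (y : V) (hy : y ∈ H.verts) (hxz : x ≠ z) (hyz : y ≠ z) :
        Relation.ReflTransGen (AdjAvoiding K z) x y := by
      by_cases hzH : z ∈ H.verts
      · exact (hn z hzH x hx y hy hxz hyz).lift id fun _ _ h ↦ ⟨hHK.2 h.1, h.2⟩
      · refine (hc x hx y hy).lift id fun u w h ↦ ⟨hHK.2 h, ?_, ?_⟩
        · rintro rfl; exact hzH h.fst_mem
        · rintro rfl; exact hzH h.snd_mem
    have key (y : V) (hy : y ∈ K.verts) (hyz : y ≠ z) :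
        ∃ x ∈ H.verts, x ≠ z ∧ Relation.ReflTransGen (AdjAvoiding K z) x y := by
      rcases hverts y hy with hy | hy
      · exact ⟨y, hy, hyz, .refl⟩
      -- A path passes `z` at most once, so from `y` one of its two ends is reached without meeting
      -- `z`.
      by_cases h1 : z ∈ (p.takeUntil y hy).support
      · have h2 : z ∉ (p.dropUntil y hy).support := by
          rw [← p.take_spec hy] at hp
          exact fun h2 ↦ hp.ne_of_mem_support_of_append hyz.symm h1 h2 rfl
        refine ⟨b, hb, ?_, reflTransGen_adjAvoiding_symm
          (Walk.reflTransGen_adjAvoiding _ (hsplit y hy).2 h2)⟩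
        rintro rfl
        exact h2 (Walk.end_mem_support _)
      · refine ⟨a, ha, ?_, Walk.reflTransGen_adjAvoiding _ (hsplit y hy).1 h1⟩
        rintro rfl
        exact h1 (Walk.start_mem_support _)
    intro x hx y hy hxz hyz
    obtain ⟨x', hx', hx'z, hxx'⟩ := key x hx hxz
    obtain ⟨y', hy', hy'z, hyy'⟩ := key y hy hyz
    exact ((reflTransGen_adjAvoiding_symm hxx').trans (hHz x' hx' y' hy' hx'z hy'z)).trans hyy'

namespace IsBlock

variable {B : G.Subgraph} (hB : G.IsBlock B)

include hB

lemma toSubgraph_le {a b : V} (ha : a ∈ B.verts) (hb : b ∈ B.verts)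
    {p : G.Walk a b} (hp : p.IsPath) : p.toSubgraph ≤ B :=
  le_sup_right.trans (hB.2 (isNonseparable_sup_toSubgraph hB.1 ha hb hp) le_sup_left)

/-- A shortest path of the whole graph between two vertices of the block lies in it by maximality.
-/
lemma dist_coe (hG : G.Connected) (x y : B.verts) : B.coe.dist x y = G.dist x y := by
  refine le_antisymm ?_ ?_
  · obtain ⟨p, hp, hl⟩ := hG.exists_path_of_dist (x : V) y
    have hle := hB.toSubgraph_le x.2 y.2 hp
    have h1 := dist_le (p.mapToSubgraph.map (Subgraph.inclusion hle))
    have h2 : (p.mapToSubgraph.map p.toSubgraph.hom).length = p.length :=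
      congrArg Walk.length p.map_mapToSubgraph_hom
    rw [Walk.length_map] at h1 h2
    rw [h2, hl] at h1
    exact h1
  · obtain ⟨p, hl⟩ := hB.1.1.exists_walk_length_eq_dist x y
    rw [← hl, ← Walk.length_map B.hom]
    exact dist_le _

lemma isTriangleFreeCB (h : G.IsTriangleFreeCB) : B.coe.IsTriangleFreeCB where
  connected := hB.1.1
  convex v r hr u hu w hw x hx := by
    simp only [distBall, distInterval, Set.mem_ofPred_eq, hB.dist_coe h.connected] at hu hw hx ⊢
    exact h.dist_le_of_geodesic hr hu hw hx
  not_adj hab hbc hac := h.not_adj (Subgraph.coe_adj_sub _ _ _ hab)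
    (Subgraph.coe_adj_sub _ _ _ hbc) (Subgraph.coe_adj_sub _ _ _ hac)

end IsBlock

lemma nonempty_iso_top_of_card_eq_one {W : Type*} (T : SimpleGraph W) (h : Nat.card W = 1) :
    Nonempty (T ≃g (⊤ : SimpleGraph (Fin 1))) := by
  have := (Nat.card_eq_one_iff_unique.1 h).1
  have := Nat.finite_of_card_ne_zero (α := W) (by omega)
  refine ⟨⟨Finite.equivFinOfCardEq h, fun {a b} ↦ ?_⟩⟩
  simp [Subsingleton.elim a b]

lemma nonempty_iso_top_of_card_eq_two {W : Type*} {T : SimpleGraph W} (hT : T.Connected)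
    (h : Nat.card W = 2) : Nonempty (T ≃g (⊤ : SimpleGraph (Fin 2))) := by
  have := Nat.finite_of_card_ne_zero (α := W) (by omega)
  let e := Finite.equivFinOfCardEq h
  refine ⟨⟨e, fun {a b} ↦ ?_⟩⟩
  rw [top_adj, e.injective.ne_iff]
  refine ⟨fun hab ↦ ?_, fun hab ↦ hab.ne⟩
  obtain ⟨p⟩ := hT a b
  cases p with
  | nil => exact absurd rfl hab
  | @cons _ c _ hac p =>
    have h1 : c = b := e.injective (by
      have h1 := e.injective.ne hab
      have h2 := e.injective.ne hac.ne
      omega)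
    exact h1 ▸ hac

end SimpleGraph

theorem mainTheorem10 {V : Type*} [Finite V] (G : SimpleGraph V) :
    ((G.IsTwoConnected ∧ G.CliqueFree 3 ∧ G.IsCBGraph) ↔ ∃ d : ℕ, G.IsMooreGraph d 2) ∧
    (G.CliqueFree 3 → G.IsCBGraph → ∀ B : G.Subgraph, G.IsBlock B →
      Nonempty (B.coe ≃g (⊤ : SimpleGraph (Fin 1))) ∨
      Nonempty (B.coe ≃g (⊤ : SimpleGraph (Fin 2))) ∨
      Nonempty (B.coe ≃g SimpleGraph.cycleGraph 5) ∨
      Nonempty (B.coe ≃g SimpleGraph.petersenGraph) ∨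
      Nonempty (B.coe ≃g SimpleGraph.hoffmanSingletonGraph) ∨
      B.coe.IsMooreGraph 57 2) := by
  refine ⟨SimpleGraph.isTwoConnected_and_cliqueFree_and_isCBGraph_iff, fun ht hcb B hB ↦ ?_⟩
  have hBcb := hB.isTriangleFreeCB (hcb.isTriangleFreeCB ht)
  have hne := hBcb.connected.nonempty
  have hpos : 0 < Nat.card B.verts := Nat.card_pos
  by_cases h1 : Nat.card B.verts = 1
  · exact .inl (SimpleGraph.nonempty_iso_top_of_card_eq_one _ h1)
  by_cases h2 : Nat.card B.verts = 2
  · exact .inr (.inl (SimpleGraph.nonempty_iso_top_of_card_eq_two hBcb.connected h2))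
  · obtain ⟨d, hd⟩ := hBcb.exists_isMooreGraph ⟨by omega, hB.1⟩
    exact .inr (.inr hd.nonempty_iso_or)
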